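/- All graphs are finite and simple. For a graph $G=(V,E)$ with $n=|V|$ vertices and real edge weights $\boldsymbol r=(r_{uv})_{(u,v)\in E}$, let $X_u,Y_u,Z_u$ denote the Pauli operators acting on qubit $u$ of $(\mathbb C^2)^{\otimes V}$, and let $\mathfrak g'_{G,\boldsymbol r}$ be the real Lie algebra of $2^n\times 2^n$ matrices (with the commutator) generated by $$\mathrm i\sum_{u\in V}X_u,\qquad \mathrm i\sum_{u\in V}Y_u,\qquad \mathrm i\sum_{(u,v)\in E}r_{uv}Z_uZ_v .$$ Let $\mathfrak{su}(2^n)$ be the real Lie algebra of traceless skew-Hermitian $2^n\times2^n$ matrices, and $\mathcal N(u)$ the set of neighbours of $u$. A graph is called odd if it is connected, has at least three vertices, and all its vertices have odd degree. An asymmetric subdivision of a graph is obtained by replacing each edge $e$ in a subset $\hat E$ of its edges by a path with $\ell_e\ge 1$ new interior vertices, where at most one edge lies outside $\hat E$ and the numbers $\ell_e$, $e\in\hat E$, are pairwise different. Then: 1. Let $G$ be connected, with $r_{uv}\ne0$ for every edge $(u,v)$, and suppose that for any family of sign functions $s_x:\mathcal N(x)\to\{\pm1\}$, $x\in V$, and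 any two distinct vertices $u,v\in V$, $$\sum_{w\in\mathcal N(u)}s_u(w)\,r_{uw}\ne\sum_{w'\in\mathcal N(v)}s_v(w')\,r_{vw'} .$$ Then $\mathfrak g'_{G,\boldsymbol r}=\mathfrak{su}(2^n)$ and $\dim_{\mathbb R}\mathfrak g'_{G,\boldsymbol r}=4^n-1$. 2. If $\boldsymbol r\equiv1$ and $G$ is an asymmetric subdivision of an odd graph, then $\mathfrak g'_{G,\boldsymbol r}=\mathfrak{su}(2^n)$ and $\dim_{\mathbb R}\mathfrak g'_{G,\boldsymbol r}=4^n-1$. 3. For almost all graphs, with $\boldsymbol r\equiv1$, $\mathfrak g'_{G,\boldsymbol r}=\mathfrak{su}(2^n)$ has dimension $4^n-1$. Precisely, there are constants $c>0$ and $N$ such that for every $n\ge N$, a fraction of at least $1-e^{-cn}$ of all graphs on the vertex set $\{1,\dots,n\}$ (that is, an Erdős–Rényi graph $G(n,\tfrac12)$ with probability at least $1-e^{-cn}$), and likewise a fraction of at least $1-e^{-cn}$ of all isomorphism classes of graphs on $n$ vertices, are connected and satisfy $\mathfrak g'_{G,\boldsymbol r}=\mathfrak{su}(2^n)$ and $\dim_{\mathbb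 R}\mathfrak g'_{G,\boldsymbol r}=4^n-1$. -/

import Mathlib

attribute [local instance] LieRing.ofAssociativeRing

universe u

noncomputable section

namespace GraphDLA

/-! ### Pauli operators on qubits indexed by the vertices -/

/-- The Pauli matrix `X`. -/
def pauliX : Matrix (Fin 2) (Fin 2) ℂ := !![0, 1; 1, 0]

/-- The Pauli matrix `Y`. -/
def pauliY : Matrix (Fin 2) (Fin 2) ℂ := !![0, -Complex.I; Complex.I, 0]

/-- The Pauli matrix `Z`. -/
def pauliZ : Matrix (Fin 2) (Fin 2) ℂ := !![1, 0; 0, -1]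

/-- Operators on the qubits labelled by `V`: complex matrices whose rows and columns are indexed
by the computational basis `V → Fin 2`, which has `2 ^ |V|` elements. -/
abbrev QubitOp (V : Type*) : Type _ := Matrix (V → Fin 2) (V → Fin 2) ℂ

/-- The tensor (Kronecker) product of the one-qubit operators `P u`, `u ∈ V`. -/
def tensorOp {V : Type*} [Fintype V] (P : V → Matrix (Fin 2) (Fin 2) ℂ) : QubitOp V :=
  Matrix.of fun x y => ∏ u, P u (x u) (y u)

/-- The one-qubit operator `A` acting on qubit `u`, and the identity on the other qubits. -/
def opAt {V : Type*} [Fintype V] [DecidableEq V] (A : Matrix (Fin 2) (Fin 2) ℂ) (u : V) :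
    QubitOp V :=
  tensorOp fun w => if w = u then A else 1

open Classical in
/-- For an edge `e = s(u, v)`, the operator `Z_u Z_v`: the matrix `Z` on the two endpoints of `e`,
and the identity on the other qubits. -/
def edgeZZ {V : Type*} [Fintype V] (e : Sym2 V) : QubitOp V :=
  tensorOp fun w => if w ∈ e then pauliZ else 1

/-- `∑_u A_u`. -/
def sumOp {V : Type*} [Fintype V] [DecidableEq V] (A : Matrix (Fin 2) (Fin 2) ℂ) : QubitOp V :=
  ∑ u : V, opAt A u

open Classical in
/-- The problem Hamiltonian `∑_{(u,v) ∈ E} r_uv Z_u Z_v` (only the values of `r` on edges count). -/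
def problemHam {V : Type*} [Fintype V] [DecidableEq V] (G : SimpleGraph V) (r : Sym2 V → ℝ) :
    QubitOp V :=
  ∑ e : Sym2 V with e ∈ G.edgeSet, r e • edgeZZ e

/-- The dynamical Lie algebra with generators `i ∑ X_u`, `i ∑ Y_u` and `i ∑ r_uv Z_u Z_v`: the
smallest real Lie algebra of matrices (with the commutator) that contains these three matrices. -/
def dla {V : Type*} [Fintype V] [DecidableEq V] (G : SimpleGraph V) (r : Sym2 V → ℝ) :
    LieSubalgebra ℝ (QubitOp V) :=
  LieSubalgebra.lieSpan ℝ (QubitOp V)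
    {Complex.I • sumOp pauliX, Complex.I • sumOp pauliY, Complex.I • problemHam G r}

/-- The real Lie algebra of traceless skew-Hermitian matrices; for a basis with `N` elements this
is `su(N)`. -/
def su (ι : Type*) [Fintype ι] [DecidableEq ι] : LieSubalgebra ℝ (Matrix ι ι ℂ) where
  carrier := {H | H.conjTranspose = -H ∧ H.trace = 0}
  add_mem' := by
    rintro A B ⟨hA, hA'⟩ ⟨hB, hB'⟩
    refine ⟨?_, ?_⟩
    · rw [Matrix.conjTranspose_add, hA, hB, neg_add]
    · rw [Matrix.trace_add, hA', hB', add_zero]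
  zero_mem' := by simp
  smul_mem' := by
    rintro c A ⟨hA, hA'⟩
    refine ⟨?_, ?_⟩
    · rw [Matrix.conjTranspose_smul, hA, star_trivial, smul_neg]
    · rw [Matrix.trace_smul, hA', smul_zero]
  lie_mem' := by
    rintro A B ⟨hA, -⟩ ⟨hB, -⟩
    refine ⟨?_, ?_⟩
    · rw [LieRing.of_associative_ring_bracket, Matrix.conjTranspose_sub,
        Matrix.conjTranspose_mul, Matrix.conjTranspose_mul, hA, hB]
      simp
    · rw [LieRing.of_associative_ring_bracket, Matrix.trace_sub, Matrix.trace_mul_comm, sub_self]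

/-! ### Conditions on the weights and on the graph -/

open Classical in
/-- The weights are nonzero on the edges, and for any sign functions `s_x : N(x) → {±1}`, the signed
weight sums at any two different vertices are different. -/
def GenericWeights {V : Type*} [Fintype V] (G : SimpleGraph V) (r : Sym2 V → ℝ) : Prop :=
  (∀ e ∈ G.edgeSet, r e ≠ 0) ∧
  ∀ s : V → V → ℝ, (∀ x w, G.Adj x w → s x w = 1 ∨ s x w = -1) →
    ∀ u v : V, u ≠ v →
      ∑ w : V with G.Adj u w, s u w * r s(u, w) ≠ ∑ w : V with G.Adj v w, s v w * r s(v, w)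

/-- An odd graph: connected, at least three vertices, all degrees odd. -/
def IsOddGraph {V : Type*} [Fintype V] (G : SimpleGraph V) : Prop :=
  G.Connected ∧ 3 ≤ Fintype.card V ∧ ∀ v, Odd (G.neighborSet v).ncard

/-- The vertices of a subdivision of `G`: those of `G`, and `len e` new ones on each edge `e`. -/
abbrev SubdivVertex {V : Type*} (G : SimpleGraph V) (len : G.edgeSet → ℕ) : Type _ :=
  V ⊕ (Σ e : G.edgeSet, Fin (len e))

/-- The oriented edges of a subdivision. The edge `e` from `src e` to `dst e` is kept if `len e = 0`
and is otherwise replaced by the path `src e, w¹, …, w^(len e), dst e`. -/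
inductive SubdivRel {V : Type*} (G : SimpleGraph V) (src dst : G.edgeSet → V)
    (len : G.edgeSet → ℕ) : SubdivVertex G len → SubdivVertex G len → Prop
  | keep (e : G.edgeSet) (h : len e = 0) :
      SubdivRel G src dst len (Sum.inl (src e)) (Sum.inl (dst e))
  | first (e : G.edgeSet) (h : 0 < len e) :
      SubdivRel G src dst len (Sum.inl (src e)) (Sum.inr ⟨e, ⟨0, h⟩⟩)
  | step (e : G.edgeSet) (j : ℕ) (h : j + 1 < len e) :
      SubdivRel G src dst len (Sum.inr ⟨e, ⟨j, Nat.lt_of_succ_lt h⟩⟩) (Sum.inr ⟨e, ⟨j + 1, h⟩⟩)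
  | last (e : G.edgeSet) (h : 0 < len e) :
      SubdivRel G src dst len (Sum.inr ⟨e, ⟨len e - 1, Nat.sub_lt h Nat.one_pos⟩⟩)
        (Sum.inl (dst e))

/-- The subdivision of `G` that puts `len e` new vertices on each edge `e`. -/
def subdivision {V : Type*} (G : SimpleGraph V) (src dst : G.edgeSet → V) (len : G.edgeSet → ℕ) :
    SimpleGraph (SubdivVertex G len) :=
  SimpleGraph.fromRel (SubdivRel G src dst len)

/-- `H` is (isomorphic to) an asymmetric subdivision of an odd graph: at most one edge is not
subdivided, and the subdivided edges get pairwise different numbers of new vertices. The functions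
`src` and `dst` orient the edges; the isomorphism type does not depend on them. -/
def IsAsymSubdividedOddGraph {V : Type u} (H : SimpleGraph V) : Prop :=
  ∃ (V₀ : Type u) (_ : Fintype V₀) (G : SimpleGraph V₀) (src dst : G.edgeSet → V₀)
    (len : G.edgeSet → ℕ),
    IsOddGraph G ∧
    (∀ e : G.edgeSet, s(src e, dst e) = (e : Sym2 V₀)) ∧
    {e | len e = 0}.Subsingleton ∧
    Set.InjOn len {e | 1 ≤ len e} ∧
    Nonempty (H ≃g subdivision G src dst len)

/-! ### Unweighted graphs on `n` vertices -/

/-- `G` is connected and its unweighted dynamical Lie algebra is `su(2^n)`, of dimension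
`4^n - 1`, where `n` is the number of vertices. -/
def UnweightedFull {V : Type*} [Fintype V] [DecidableEq V] (G : SimpleGraph V) : Prop :=
  G.Connected ∧ dla G (fun _ => 1) = su (V → Fin 2) ∧
    Module.finrank ℝ (dla G (fun _ => 1)) = 4 ^ Fintype.card V - 1

/-- Isomorphism of graphs with vertex set `{0, …, n - 1}`. -/
def isoSetoid (n : ℕ) : Setoid (SimpleGraph (Fin n)) where
  r G H := Nonempty (G ≃g H)
  iseqv :=
    { refl := fun _ => ⟨SimpleGraph.Iso.refl⟩
      symm := fun ⟨f⟩ => ⟨f.symm⟩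
      trans := fun ⟨f⟩ ⟨g⟩ => ⟨f.trans g⟩ }

/-- Isomorphism classes of graphs on `n` vertices. -/
abbrev GraphClass (n : ℕ) : Type := Quotient (isoSetoid n)

end GraphDLA

end

noncomputable section

namespace GraphDLA

section

variable {V : Type*} [Fintype V] [DecidableEq V]

/-! ### Algebra of tensor products of one-qubit operators -/

/-! Call a vertex set `S` controlled if `g` contains the collective rotations `i X_S`, `i Y_S`, `i
Z_S`. Commutators of collective Paulis live on intersections, and the whole vertex set is
controlled, so the controlled sets form a Boolean algebra. The main task is to control every single
vertex.

The source of new controlled sets is `controls_of_disjoint_spectra`. The problem Hamiltonian is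
diagonal, so its double commutator multiplies the entry `(x, y)` of a matrix by `-(h x - h y) ^ 2`.
If `x` and `y` differ only at `u`, this is minus four times the square of a signed sum of the
weights at `u`. When these squares for `u ∈ R` avoid those for `v ∈ S \ R`, Lagrange interpolation
gives a polynomial in the double commutator that cuts a collective rotation on `S` down to `R`.
Generic weights permit `R = {u}` at once.

For unit weights the parity of a signed sum is the parity of its number of terms. A polynomial in
the adjoint action of `X_T` isolates the edges crossing `T` (`cross_mem`), and parities on either
side of `T` then show that the vertices with an odd number of neighbours in a controlled `T` are
controlled (`Controls.oddNbrs`). What remains is combinatorial: every Boolean algebra of vertex sets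
closed under `oddNbrs` should contain the singletons (`ParityDiscrete`).

Once all singletons are controlled, each edge term can be isolated; connectivity links every pair of
qubits, and all nonidentity Pauli strings follow (`pauliString_mem`). Their multiples by `i` are a
real basis of `su`.

In a subdivided odd graph the original vertices have odd degree and the path vertices degree two.
Signals sent from the path ends meet in the middle and return; distinct lengths tell the paths
apart, hence their end pairs, hence the vertices.

For random graphs, iterating `oddNbrs` from the full set gives the vectors `A ^ i * 1` over the
field with two elements. Rank-two perturbations of `A` show that a given pair `u`, `v` is rarely
left unseparated by all of them (`card_forall_orthogonal_le`); union bounds over pairs and over cuts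
finish the labelled count. Burnside's lemma shows that the number of isomorphism classes is nearly
the number of graphs divided by `n!`, which transfers the estimate to classes. -/

theorem tensorOp_mul (P Q : V → Matrix (Fin 2) (Fin 2) ℂ) :
    tensorOp P * tensorOp Q = tensorOp fun u => P u * Q u := by
  ext x y
  simp only [tensorOp, Matrix.mul_apply, Matrix.of_apply, Fintype.prod_sum,
    Finset.prod_mul_distrib]

theorem trace_tensorOp (P : V → Matrix (Fin 2) (Fin 2) ℂ) :
    (tensorOp P).trace = ∏ u, (P u).trace := by
  simp only [tensorOp, Matrix.trace, Matrix.diag_apply, Matrix.of_apply, Fintype.prod_sum]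

theorem opAt_apply (A : Matrix (Fin 2) (Fin 2) ℂ) (u : V) (x y : V → Fin 2) :
    opAt A u x y = if ∀ w, w ≠ u → x w = y w then A (x u) (y u) else 0 := by
  simp only [opAt, tensorOp, Matrix.of_apply]
  rw [← Finset.mul_prod_erase _ _ (Finset.mem_univ u)]
  rw [Finset.prod_congr (g := fun w => if x w = y w then (1 : ℂ) else 0) rfl]
  · rw [Finset.prod_ite_zero]
    simp
  · intro w hw
    simp [Finset.ne_of_mem_erase hw, Matrix.one_apply]

theorem opAt_smul (c : ℂ) (A : Matrix (Fin 2) (Fin 2) ℂ) (u : V) :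
    opAt (c • A) u = c • opAt A u := by
  ext x y
  simp only [opAt_apply, Matrix.smul_apply]
  split_ifs <;> simp

theorem opAt_sub (A B : Matrix (Fin 2) (Fin 2) ℂ) (u : V) :
    opAt (A - B) u = opAt A u - opAt B u := by
  ext x y
  simp only [opAt_apply, Matrix.sub_apply]
  split_ifs <;> simp

theorem opAt_mul (A B : Matrix (Fin 2) (Fin 2) ℂ) (u : V) :
    opAt A u * opAt B u = opAt (A * B) u := by
  rw [opAt, opAt, tensorOp_mul, opAt]
  congr 1
  funext w
  split_ifs <;> simp

theorem opAt_mul_comm (A B : Matrix (Fin 2) (Fin 2) ℂ) {u v : V} (h : u ≠ v) :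
    opAt A u * opAt B v = opAt B v * opAt A u := by
  rw [opAt, opAt, tensorOp_mul, tensorOp_mul]
  congr 1
  funext w
  by_cases hu : w = u
  · have hv : w ≠ v := fun hv => h (hu.symm.trans hv)
    simp [hu, h]
  · simp [hu]

theorem lie_opAt_same (A B : Matrix (Fin 2) (Fin 2) ℂ) (u : V) :
    ⁅opAt A u, opAt B u⁆ = opAt ⁅A, B⁆ u := by
  rw [LieRing.of_associative_ring_bracket, LieRing.of_associative_ring_bracket, opAt_mul, opAt_mul,
    opAt_sub]

theorem lie_opAt_of_ne (A B : Matrix (Fin 2) (Fin 2) ℂ) {u v : V} (h : u ≠ v) :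
    ⁅opAt A u, opAt B v⁆ = 0 := by
  rw [LieRing.of_associative_ring_bracket, opAt_mul_comm A B h, sub_self]

theorem edgeZZ_mk {u v : V} (h : u ≠ v) : edgeZZ s(u, v) = opAt pauliZ u * opAt pauliZ v := by
  rw [opAt, opAt, tensorOp_mul, edgeZZ]
  congr 1
  funext w
  by_cases hu : w = u
  · simp [hu, h]
  · simp [hu]

theorem lie_pauliX_pauliY : ⁅pauliX, pauliY⁆ = (2 * Complex.I) • pauliZ := by
  rw [LieRing.of_associative_ring_bracket]
  ext i j
  fin_cases i <;> fin_cases j <;> simp [pauliX, pauliY, pauliZ] <;> ring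

theorem lie_pauliY_pauliZ : ⁅pauliY, pauliZ⁆ = (2 * Complex.I) • pauliX := by
  rw [LieRing.of_associative_ring_bracket]
  ext i j
  fin_cases i <;> fin_cases j <;> simp [pauliX, pauliY, pauliZ] <;> ring

theorem lie_pauliZ_pauliX : ⁅pauliZ, pauliX⁆ = (2 * Complex.I) • pauliY := by
  rw [LieRing.of_associative_ring_bracket]
  ext i j
  fin_cases i <;> fin_cases j <;> simp [pauliX, pauliY, pauliZ] <;> ring_nf <;>
    simp

/-! ### Sets of qubits on which all local rotations are available -/

/-- `∑_{u ∈ S} A_u`. -/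
def setOp (A : Matrix (Fin 2) (Fin 2) ℂ) (S : Set V) : QubitOp V :=
  ∑ u, S.indicator (opAt A) u

theorem setOp_univ (A : Matrix (Fin 2) (Fin 2) ℂ) : setOp A (Set.univ : Set V) = sumOp A := by
  simp [setOp, sumOp]

theorem setOp_singleton (A : Matrix (Fin 2) (Fin 2) ℂ) (u : V) : setOp A {u} = opAt A u := by
  rw [setOp, Finset.sum_eq_single u]
  · simp
  · intro w _ hw
    simp [hw]
  · simp

theorem setOp_compl (A : Matrix (Fin 2) (Fin 2) ℂ) (S : Set V) :
    setOp A Sᶜ = sumOp A - setOp A S := by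
  rw [setOp, setOp, sumOp, ← Finset.sum_sub_distrib]
  refine Finset.sum_congr rfl fun u _ => ?_
  by_cases hu : u ∈ S <;> simp [hu]

theorem setOp_smul (c : ℂ) (A : Matrix (Fin 2) (Fin 2) ℂ) (S : Set V) :
    setOp (c • A) S = c • setOp A S := by
  rw [setOp, setOp, Finset.smul_sum]
  refine Finset.sum_congr rfl fun u _ => ?_
  by_cases hu : u ∈ S <;> simp [hu, opAt_smul]

theorem lie_setOp_opAt (A B : Matrix (Fin 2) (Fin 2) ℂ) (S : Set V) (v : V) :
    ⁅setOp A S, opAt B v⁆ = S.indicator (opAt ⁅A, B⁆) v := by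
  rw [setOp, sum_lie, Finset.sum_eq_single v]
  · by_cases hv : v ∈ S <;> simp [hv, lie_opAt_same]
  · intro u _ hu
    by_cases hS : u ∈ S <;> simp [hS, lie_opAt_of_ne _ _ hu]
  · simp

/-- Operators on different qubits commute, so only qubits in both sets contribute. This is why
controlled sets are closed under intersection. -/
theorem lie_setOp (A B : Matrix (Fin 2) (Fin 2) ℂ) (S T : Set V) :
    ⁅setOp A S, setOp B T⁆ = setOp ⁅A, B⁆ (S ∩ T) := by
  rw [setOp.eq_def B T, lie_sum, setOp.eq_def _ (S ∩ T)]
  refine Finset.sum_congr rfl fun v _ => ?_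
  by_cases hT : v ∈ T <;> by_cases hS : v ∈ S <;> simp [hT, hS, lie_setOp_opAt]

/-- All rotations that act in the same way on the qubits of `S`, and trivially on the others, have
their generators in `g`. -/
def Controls (g : LieSubalgebra ℝ (QubitOp V)) (S : Set V) : Prop :=
  Complex.I • setOp pauliX S ∈ g ∧ Complex.I • setOp pauliY S ∈ g ∧ Complex.I • setOp pauliZ S ∈ g

theorem lie_I_smul (a b : QubitOp V) : ⁅Complex.I • a, Complex.I • b⁆ = -⁅a, b⁆ := by
  simp only [LieRing.of_associative_ring_bracket, Matrix.smul_mul, Matrix.mul_smul, smul_smul,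
    Complex.I_mul_I]
  module

/-- The factors of `i` combine so that the commutator of `i a` and `i b` is `-2 (i c)`: a real
multiple, as a real Lie algebra requires. -/
theorem mem_of_lie_two_I {g : LieSubalgebra ℝ (QubitOp V)} {a b c : QubitOp V}
    (ha : Complex.I • a ∈ g) (hb : Complex.I • b ∈ g) (h : ⁅a, b⁆ = (2 * Complex.I) • c) :
    Complex.I • c ∈ g := by
  have h1 := g.smul_mem (-1 / 2) (g.lie_mem ha hb)
  rw [lie_I_smul, h] at h1
  convert h1 using 1
  ext x y
  simp
  ring

theorem Controls.of_pauliX_pauliY {g : LieSubalgebra ℝ (QubitOp V)} {S : Set V}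
    (hX : Complex.I • setOp pauliX S ∈ g) (hY : Complex.I • setOp pauliY S ∈ g) :
    Controls g S := by
  refine ⟨hX, hY, mem_of_lie_two_I hX hY ?_⟩
  rw [lie_setOp, lie_pauliX_pauliY, setOp_smul, Set.inter_self]

theorem Controls.inter {g : LieSubalgebra ℝ (QubitOp V)} {S T : Set V}
    (hS : Controls g S) (hT : Controls g T) : Controls g (S ∩ T) := by
  refine ⟨mem_of_lie_two_I hS.2.1 hT.2.2 ?_, mem_of_lie_two_I hS.2.2 hT.1 ?_,
    mem_of_lie_two_I hS.1 hT.2.1 ?_⟩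
  · rw [lie_setOp, lie_pauliY_pauliZ, setOp_smul]
  · rw [lie_setOp, lie_pauliZ_pauliX, setOp_smul]
  · rw [lie_setOp, lie_pauliX_pauliY, setOp_smul]

theorem Controls.compl {g : LieSubalgebra ℝ (QubitOp V)} {S : Set V}
    (h : Controls g Set.univ) (hS : Controls g S) : Controls g Sᶜ := by
  simp only [Controls, setOp_compl, smul_sub]
  simp only [Controls, setOp_univ] at h
  exact ⟨g.sub_mem h.1 hS.1, g.sub_mem h.2.1 hS.2.1, g.sub_mem h.2.2 hS.2.2⟩

theorem controls_univ_dla (G : SimpleGraph V) (r : Sym2 V → ℝ) : Controls (dla G r) Set.univ := by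
  refine Controls.of_pauliX_pauliY ?_ ?_ <;> rw [setOp_univ] <;>
    exact LieSubalgebra.subset_lieSpan (by simp)

theorem problemHam_mem_dla (G : SimpleGraph V) (r : Sym2 V → ℝ) :
    Complex.I • problemHam G r ∈ dla G r :=
  LieSubalgebra.subset_lieSpan (by simp)

/-! ### Isolating the edges that cross a controlled set -/

open Classical in
/-- The weights `w` on the edges with exactly one end in `T`, and `0` elsewhere. -/
def crossWeights (T : Set V) (w : Sym2 V → ℝ) (e : Sym2 V) : ℝ :=
  if (∃ u ∈ e, u ∈ T) ∧ ∃ u ∈ e, u ∉ T then w e else 0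

theorem lie_mul_right (a b c : QubitOp V) : ⁅a, b * c⁆ = ⁅a, b⁆ * c + b * ⁅a, c⁆ := by
  simp only [LieRing.of_associative_ring_bracket]
  noncomm_ring

/-- The generator of the rotation about the `X` axis on the qubits of `T`. -/
def xRotation (T : Set V) : QubitOp V := (1 / 2 : ℝ) • Complex.I • setOp pauliX T

theorem lie_xRotation (T : Set V) (a : QubitOp V) :
    ⁅xRotation T, a⁆ = (Complex.I / 2) • ⁅setOp pauliX T, a⁆ := by
  rw [xRotation]
  simp only [LieRing.of_associative_ring_bracket]
  ext x y
  simp [mul_sub]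
  ring

theorem lie_xRotation_pauliZ (T : Set V) (u : V) :
    ⁅xRotation T, opAt pauliZ u⁆ = T.indicator (opAt pauliY) u := by
  rw [lie_xRotation, lie_setOp_opAt, ← lie_skew, lie_pauliZ_pauliX]
  by_cases hu : u ∈ T
  · simp only [hu, Set.indicator_of_mem]
    rw [← neg_smul, opAt_smul, smul_smul]
    convert one_smul ℂ _
    ring_nf
    simp
  · simp [hu]

theorem lie_xRotation_pauliY (T : Set V) (u : V) :
    ⁅xRotation T, opAt pauliY u⁆ = -T.indicator (opAt pauliZ) u := by
  rw [lie_xRotation, lie_setOp_opAt, lie_pauliX_pauliY]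
  by_cases hu : u ∈ T
  · simp only [hu, Set.indicator_of_mem]
    rw [opAt_smul, smul_smul, ← neg_one_smul ℂ]
    congr 1
    ring_nf
    simp
  · simp [hu]

/-- On `Z_u Z_v` the adjoint action has frequencies 0, `±i` or in `{0, ±2i}` according as zero, one
or two ends lie in `T`. The polynomial `t ^ 4 + 4 t ^ 2` vanishes at 0 and `±2i` and equals `-3` at
`±i`, so only crossing edges survive. -/
theorem lie_xRotation_edgeZZ (T : Set V) {u v : V} (h : u ≠ v) (w : Sym2 V → ℝ) :
    w s(u, v) • (⁅xRotation T, ⁅xRotation T, ⁅xRotation T, ⁅xRotation T, edgeZZ s(u, v)⁆⁆⁆⁆ +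
      (4 : ℝ) • ⁅xRotation T, ⁅xRotation T, edgeZZ s(u, v)⁆⁆) =
      (-3 : ℝ) • crossWeights T w s(u, v) • edgeZZ s(u, v) := by
  rw [edgeZZ_mk h]
  by_cases hu : u ∈ T <;> by_cases hv : v ∈ T <;>
    simp [hu, hv, lie_mul_right, lie_xRotation_pauliZ, lie_xRotation_pauliY, crossWeights] <;>
    module

theorem cross_mem {g : LieSubalgebra ℝ (QubitOp V)} {G : SimpleGraph V} {w : Sym2 V → ℝ}
    {T : Set V} (hT : Controls g T) (hw : Complex.I • problemHam G w ∈ g) :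
    Complex.I • problemHam G (crossWeights T w) ∈ g := by
  have hX : xRotation T ∈ g := g.smul_mem _ hT.1
  have key : ⁅xRotation T, ⁅xRotation T, ⁅xRotation T, ⁅xRotation T, problemHam G w⁆⁆⁆⁆ +
      (4 : ℝ) • ⁅xRotation T, ⁅xRotation T, problemHam G w⁆⁆ =
      (-3 : ℝ) • problemHam G (crossWeights T w) := by
    simp only [problemHam, lie_sum, Finset.smul_sum, ← Finset.sum_add_distrib]
    refine Finset.sum_congr rfl fun e he => ?_
    induction e with
    | _ u v =>
      have h : u ≠ v := G.ne_of_adj (by simpa using he)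
      rw [← lie_xRotation_edgeZZ T h w, smul_add]
      simp only [lie_smul]
      rw [smul_comm]
  have h4 := g.add_mem (g.lie_mem hX (g.lie_mem hX (g.lie_mem hX (g.lie_mem hX hw))))
    (g.smul_mem 4 (g.lie_mem hX (g.lie_mem hX hw)))
  have h5 := g.smul_mem (-1 / 3) h4
  convert h5 using 1
  simp only [lie_smul]
  rw [smul_comm (4 : ℝ) Complex.I, ← smul_add, key]
  module

end

section

variable {V : Type*} [Fintype V] [DecidableEq V]

/-! ### Separating qubits by the spectrum of their neighbourhoods -/

/-- The eigenvalue `±1` of `Z` on a basis state of a qubit. -/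
def bitSign (b : Fin 2) : ℝ := if b = 0 then 1 else -1

theorem bitSign_eq (b : Fin 2) : bitSign b = 1 ∨ bitSign b = -1 := by
  fin_cases b <;> simp [bitSign]

theorem bitSign_sq (b : Fin 2) : bitSign b ^ 2 = 1 := by
  rcases bitSign_eq b with h | h <;> simp [h]

theorem bitSign_of_ne {b c : Fin 2} (h : b ≠ c) : bitSign c = -bitSign b := by
  fin_cases b <;> fin_cases c <;> simp_all [bitSign]

open Classical in
/-- The eigenvalue of `Z_u Z_v`, for `e = s(u, v)`, on a basis state. -/
def edgeSign (e : Sym2 V) (x : V → Fin 2) : ℝ := ∏ w, if w ∈ e then bitSign (x w) else 1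

theorem edgeSign_mk {u v : V} (h : u ≠ v) (x : V → Fin 2) :
    edgeSign s(u, v) x = bitSign (x u) * bitSign (x v) := by
  rw [edgeSign, ← Finset.mul_prod_erase _ _ (Finset.mem_univ u),
    ← Finset.mul_prod_erase _ _ (Finset.mem_erase.2 ⟨h.symm, Finset.mem_univ v⟩),
    Finset.prod_eq_one, mul_one]
  · simp
  · intro w hw
    simp only [Finset.mem_erase] at hw
    simp [hw.1, hw.2.1]

theorem edgeSign_congr {e : Sym2 V} {x y : V → Fin 2} (h : ∀ w ∈ e, x w = y w) :
    edgeSign e x = edgeSign e y := by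
  refine Finset.prod_congr rfl fun w _ => ?_
  split_ifs with hw
  · rw [h w hw]
  · rfl

theorem edgeZZ_eq_diagonal (e : Sym2 V) :
    edgeZZ e = Matrix.diagonal fun x => (edgeSign e x : ℂ) := by
  ext x y
  rw [Matrix.diagonal_apply]
  simp only [edgeZZ, tensorOp, Matrix.of_apply, edgeSign, Complex.ofReal_prod]
  split_ifs with h
  · subst h
    refine Finset.prod_congr rfl fun w _ => ?_
    split_ifs
    · generalize x w = a
      fin_cases a <;> simp [pauliZ, bitSign]
    · simp
  · obtain ⟨w, hw⟩ := Function.ne_iff.1 h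
    refine Finset.prod_eq_zero (Finset.mem_univ w) ?_
    split_ifs
    · generalize x w = a at *
      generalize y w = b at *
      fin_cases a <;> fin_cases b <;> simp_all [pauliZ]
    · simp [hw]

open Classical in
/-- The diagonal entries of the problem Hamiltonian. -/
def energy (G : SimpleGraph V) (w : Sym2 V → ℝ) (x : V → Fin 2) : ℝ :=
  ∑ e : Sym2 V with e ∈ G.edgeSet, w e * edgeSign e x

theorem problemHam_eq_diagonal (G : SimpleGraph V) (w : Sym2 V → ℝ) :
    problemHam G w = Matrix.diagonal fun x => (energy G w x : ℂ) := by
  ext x y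
  simp only [problemHam, edgeZZ_eq_diagonal, Matrix.sum_apply, Matrix.smul_apply,
    Matrix.diagonal_apply, energy]
  split_ifs <;> simp

open Classical in
/-- The eigenvalue of `∑_{v ∈ N(u)} w_uv Z_v` on a basis state. -/
def signedSum (G : SimpleGraph V) (w : Sym2 V → ℝ) (u : V) (x : V → Fin 2) : ℝ :=
  ∑ v : V with G.Adj u v, bitSign (x v) * w s(u, v)

omit [DecidableEq V] in
open Classical in
theorem sum_incident (G : SimpleGraph V) (u : V) (F : Sym2 V → ℝ)
    (hF : ∀ e ∈ G.edgeSet, u ∉ e → F e = 0) :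
    ∑ e : Sym2 V with e ∈ G.edgeSet, F e = ∑ v : V with G.Adj u v, F s(u, v) := by
  symm
  refine Finset.sum_of_injOn (fun v => s(u, v)) ?_ ?_ ?_ ?_
  · intro a _ b _ h
    exact Sym2.congr_right.1 h
  · intro v hv
    simpa using hv
  · intro e he hne
    refine hF e (by simpa using he) fun hu => hne ?_
    obtain ⟨v, rfl⟩ := Sym2.mem_iff_exists.1 hu
    exact ⟨v, by simpa using he, rfl⟩
  · intros
    rfl

/-- Flipping qubit `u` changes the sign of exactly the edge terms at `u`; squaring removes the sign
of `u` itself. -/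
theorem sq_energy_sub (G : SimpleGraph V) (w : Sym2 V → ℝ) {u : V} {x y : V → Fin 2}
    (h : ∀ v, v ≠ u → x v = y v) (hu : x u ≠ y u) :
    (energy G w x - energy G w y) ^ 2 = 4 * signedSum G w u x ^ 2 := by
  classical
  have key : energy G w x - energy G w y = 2 * bitSign (x u) * signedSum G w u x := by
    rw [energy, energy, ← Finset.sum_sub_distrib, sum_incident G u, signedSum, Finset.mul_sum]
    · refine Finset.sum_congr rfl fun v hv => ?_
      have huv : u ≠ v := G.ne_of_adj (by simpa using hv)
      rw [edgeSign_mk huv, edgeSign_mk huv, ← h v huv.symm, bitSign_of_ne hu]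
      ring
    · intro e _ hue
      rw [edgeSign_congr (y := y) fun v hv => h v (by rintro rfl; exact hue hv), sub_self]
  rw [key, mul_pow, mul_pow, bitSign_sq]
  ring

/-- Entrywise multiplication by a polynomial in `-(h x - h y) ^ 2` preserves a real Lie algebra that
contains the diagonal matrix with entries `i h x`. -/
theorem entrywise_polynomial_mem {ι : Type*} [Fintype ι] [DecidableEq ι]
    {g : LieSubalgebra ℝ (Matrix ι ι ℂ)} {h : ι → ℝ}
    (hg : Complex.I • (Matrix.diagonal fun x => (h x : ℂ)) ∈ g) {M : Matrix ι ι ℂ} (hM : M ∈ g)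
    (p : Polynomial ℝ) :
    (Matrix.of fun x y => ((p.eval (-(h x - h y) ^ 2) : ℝ) : ℂ) * M x y) ∈ g := by
  induction p using Polynomial.induction_on' with
  | add p q hp hq =>
    convert g.add_mem hp hq using 1
    ext x y
    simp [add_mul]
  | monomial n a =>
    induction n generalizing a with
    | zero =>
      convert g.smul_mem a hM using 1
      ext x y
      simp
    | succ n ih =>
      -- Two commutators with the diagonal matrix multiply each entry by `(i (h x - h y)) ^ 2`,
      -- raising the degree of the monomial by one.
      convert g.lie_mem hg (g.lie_mem hg (ih a)) using 1
      ext x y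
      simp only [LieRing.of_associative_ring_bracket, Matrix.smul_mul, Matrix.mul_smul,
        Matrix.sub_apply, Matrix.smul_apply, Matrix.diagonal_mul, Matrix.mul_diagonal,
        Matrix.of_apply, Polynomial.eval_monomial, smul_eq_mul]
      push_cast
      linear_combination (-(↑a * (-(↑(h x) - ↑(h y)) ^ 2) ^ n * M x y *
        ((h x : ℂ) - h y) ^ 2)) * Complex.I_mul_I

theorem exists_polynomial_one_zero {A B : Set ℝ} (hA : A.Finite) (hB : B.Finite)
    (h : Disjoint A B) :
    ∃ p : Polynomial ℝ, (∀ a ∈ A, p.eval a = 1) ∧ ∀ b ∈ B, p.eval b = 0 := by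
  classical
  have hinj : Set.InjOn id ((hA.union hB).toFinset : Set ℝ) := Function.injective_id.injOn
  refine ⟨Lagrange.interpolate (hA.union hB).toFinset id (A.indicator 1), fun a ha => ?_,
    fun b hb => ?_⟩
  · have := Lagrange.eval_interpolate_at_node (i := a) (A.indicator 1) hinj (by simp [ha])
    simpa [ha] using this
  · have hbA : b ∉ A := fun hbA => Set.disjoint_left.1 h hbA hb
    have := Lagrange.eval_interpolate_at_node (i := b) (A.indicator 1) hinj (by simp [hb])
    simpa [hbA] using this

/-- The interpolating polynomial is 1 on the values coming from `R` and 0 on those from `S \ R`, so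
it acts as a projection onto the part of a collective off-diagonal Pauli on `R`. `Z` has diagonal
entries and is recovered from `X` and `Y`. -/
theorem controls_of_disjoint_spectra {g : LieSubalgebra ℝ (QubitOp V)} {G : SimpleGraph V}
    {w : Sym2 V → ℝ} {S R : Set V} (hw : Complex.I • problemHam G w ∈ g) (hS : Controls g S)
    (hRS : R ⊆ S)
    (h : ∀ u ∈ R, ∀ v ∈ S \ R, ∀ x y, signedSum G w u x ^ 2 ≠ signedSum G w v y ^ 2) :
    Controls g R := by
  obtain ⟨p, hp1, hp0⟩ := exists_polynomial_one_zero
    (A := (fun a : V × (V → Fin 2) => -(4 * signedSum G w a.1 a.2 ^ 2)) '' {a | a.1 ∈ R})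
    (B := (fun a : V × (V → Fin 2) => -(4 * signedSum G w a.1 a.2 ^ 2)) '' {a | a.1 ∈ S \ R})
    (Set.toFinite _) (Set.toFinite _) (by
      rw [Set.disjoint_left]
      rintro _ ⟨⟨u, x⟩, hu, rfl⟩ ⟨⟨v, y⟩, hv, hxy⟩
      refine h u hu v hv x y ?_
      simp only at hxy
      linarith)
  have key : ∀ P : Matrix (Fin 2) (Fin 2) ℂ, (∀ b, P b b = 0) → Complex.I • setOp P S ∈ g →
      Complex.I • setOp P R ∈ g := by
    intro P hP hmem
    rw [problemHam_eq_diagonal] at hw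
    convert entrywise_polynomial_mem hw hmem p using 1
    ext x y
    simp only [Matrix.smul_apply, Matrix.of_apply, setOp, Matrix.sum_apply, smul_eq_mul]
    rw [mul_left_comm, Finset.mul_sum _ _ (Complex.ofReal _)]
    congr 1
    refine Finset.sum_congr rfl fun u _ => ?_
    by_cases huS : u ∈ S
    swap
    · have huR : u ∉ R := fun huR => huS (hRS huR)
      simp [huS, huR]
    by_cases hxy : (∀ v, v ≠ u → x v = y v) ∧ x u ≠ y u
    · rw [sq_energy_sub G w hxy.1 hxy.2]
      by_cases huR : u ∈ R
      · rw [hp1 _ ⟨(u, x), huR, rfl⟩]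
        simp [huS, huR]
      · rw [hp0 _ ⟨(u, x), ⟨huS, huR⟩, rfl⟩]
        simp [huR]
    · have h0 : opAt P u x y = 0 := by
        rw [opAt_apply]
        split_ifs with h1
        · by_cases h2 : x u = y u
          · rw [h2, hP]
          · exact absurd ⟨h1, h2⟩ hxy
        · rfl
      by_cases huR : u ∈ R <;> simp [huS, huR, h0]
  refine Controls.of_pauliX_pauliY (key _ ?_ hS.1) (key _ ?_ hS.2.1) <;> intro b <;>
    fin_cases b <;> simp [pauliX, pauliY]

/-- Equal squares mean signed sums equal up to a sign, and that sign can be absorbed into the sign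
function at `v`. -/
theorem controls_singleton_of_genericWeights {G : SimpleGraph V} {r : Sym2 V → ℝ}
    (h : GenericWeights G r) (u : V) : Controls (dla G r) {u} := by
  classical
  refine controls_of_disjoint_spectra (problemHam_mem_dla G r) (controls_univ_dla G r)
    (Set.subset_univ _) ?_
  intro a ha v ⟨_, hvu⟩ x y hxy
  rw [Set.mem_singleton_iff.1 ha] at hxy
  have hne : u ≠ v := fun h => hvu h.symm
  have key : ∀ c : ℝ, c = 1 ∨ c = -1 → signedSum G r u x ≠ c * signedSum G r v y := by
    intro c hc
    -- One family of signs must serve both vertices: it follows `x` around `u` and `c` times `y`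
    -- around every other vertex.
    have := h.2 (fun a b => if a = u then bitSign (x b) else c * bitSign (y b)) (by
      intro a b _
      have h1 := bitSign_eq (x b)
      have h2 := bitSign_eq (y b)
      split_ifs
      · exact h1
      · rcases hc with rfl | rfl <;> rcases h2 with h2 | h2 <;> simp [h2]) u v hne
    simp only [hne.symm, if_true, if_false] at this
    rw [signedSum, signedSum, Finset.mul_sum]
    simpa only [mul_assoc] using this
  rcases sq_eq_sq_iff_eq_or_eq_neg.1 hxy with h1 | h1
  · exact key 1 (Or.inl rfl) (by linarith)
  · exact key (-1) (Or.inr rfl) (by linarith)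

end

section

variable {V : Type*} [Fintype V] [DecidableEq V]

/-! ### Parity of the number of neighbours in a controlled set -/

omit [Fintype V] [DecidableEq V] in
-- Since `1` and `-1` are congruent modulo 2, the parity of the sum does not depend on the signs.
theorem exists_sum_bitSign_eq (F : Finset V) (x : V → Fin 2) :
    ∃ m : ℤ, ∑ v ∈ F, bitSign (x v) = m ∧ (Odd m ↔ Odd F.card) := by
  classical
  induction F using Finset.induction_on with
  | empty => exact ⟨0, by simp⟩
  | insert a F ha ih =>
    obtain ⟨m, hm, hodd⟩ := ih
    rw [Finset.sum_insert ha, Finset.card_insert_of_notMem ha, hm]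
    rcases bitSign_eq (x a) with h | h
    · refine ⟨1 + m, by rw [h]; push_cast; ring, ?_⟩
      rw [Nat.odd_add_one, ← hodd, Int.odd_iff, Int.odd_iff]
      omega
    · refine ⟨-1 + m, by rw [h]; push_cast; ring, ?_⟩
      rw [Nat.odd_add_one, ← hodd, Int.odd_iff, Int.odd_iff]
      omega

/-- The vertices with an odd number of neighbours in `T`. -/
def oddNbrs {V : Type*} (G : SimpleGraph V) (T : Set V) : Set V :=
  {u | Odd (G.neighborSet u ∩ T).ncard}

omit [DecidableEq V] in
-- At vertices of `S` only neighbours in `T` carry weight, so both signed sums are integers, one odd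
-- and one even; their squares differ.
theorem signedSum_sq_ne {G : SimpleGraph V} {w : Sym2 V → ℝ} {T S : Set V}
    (hw : ∀ u ∈ S, ∀ v, G.Adj u v → w s(u, v) = T.indicator 1 v) {u v : V} (hu : u ∈ S)
    (hv : v ∈ S) (huT : u ∈ oddNbrs G T) (hvT : v ∉ oddNbrs G T) (x y : V → Fin 2) :
    signedSum G w u x ^ 2 ≠ signedSum G w v y ^ 2 := by
  classical
  have key : ∀ u ∈ S, ∀ x, ∃ m : ℤ, signedSum G w u x = m ∧ (Odd m ↔ u ∈ oddNbrs G T) := by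
    intro u hu x
    obtain ⟨m, hm, hodd⟩ := exists_sum_bitSign_eq
      (Finset.univ.filter fun v => G.Adj u v ∧ v ∈ T) x
    refine ⟨m, ?_, ?_⟩
    · rw [← hm, signedSum, ← Finset.filter_filter, Finset.sum_filter (fun v => v ∈ T)]
      refine Finset.sum_congr rfl fun v hv => ?_
      rw [hw u hu v (by simpa using hv), Set.indicator_apply]
      split_ifs <;> simp
    · rw [hodd, oddNbrs, Set.mem_ofPred_eq, ← Set.ncard_coe_finset]
      congr! 3
      ext v
      simp
  obtain ⟨m, hm, hm'⟩ := key u hu x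
  obtain ⟨k, hk, hk'⟩ := key v hv y
  rw [hm, hk]
  intro h
  have h2 : m ^ 2 = k ^ 2 := by exact_mod_cast h
  refine hvT (hk'.1 ?_)
  have := hm'.2 huT
  rcases sq_eq_sq_iff_eq_or_eq_neg.1 h2 with h3 | h3
  · rwa [← h3]
  · rw [h3] at this
    simpa using this

theorem problemHam_sub (G : SimpleGraph V) (w w' : Sym2 V → ℝ) :
    problemHam G (w - w') = problemHam G w - problemHam G w' := by
  simp only [problemHam, Pi.sub_apply, sub_smul, Finset.sum_sub_distrib]

/-- For a vertex of `T`, its neighbours in `T` are seen by the noncrossing edges; for a vertex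
outside `T`, by the crossing edges. The two halves are found separately and joined by De Morgan. -/
theorem Controls.oddNbrs {g : LieSubalgebra ℝ (QubitOp V)} {G : SimpleGraph V}
    (hw : Complex.I • problemHam G (fun _ => 1) ∈ g) (h : Controls g Set.univ) {T : Set V}
    (hT : Controls g T) : Controls g (oddNbrs G T) := by
  have hcross := cross_mem hT hw
  have h1 : Controls g (T ∩ GraphDLA.oddNbrs G T) := by
    have hin : Complex.I • problemHam G ((fun _ => 1) - crossWeights T fun _ => 1) ∈ g := by
      rw [problemHam_sub, smul_sub]
      exact g.sub_mem hw hcross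
    refine controls_of_disjoint_spectra hin hT Set.inter_subset_left fun u hu v hv x y =>
      signedSum_sq_ne (S := T) (T := T) ?_ hu.1 hv.1 hu.2 (fun hv' => hv.2 ⟨hv.1, hv'⟩) x y
    intro u hu v _
    by_cases hv : v ∈ T <;> simp [crossWeights, hu, hv]
  have h2 : Controls g (Tᶜ ∩ GraphDLA.oddNbrs G T) := by
    refine controls_of_disjoint_spectra hcross (h.compl hT) Set.inter_subset_left
      fun u hu v hv x y =>
        signedSum_sq_ne (S := Tᶜ) (T := T) ?_ hu.1 hv.1 hu.2 (fun hv' => hv.2 ⟨hv.1, hv'⟩) x y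
    intro u hu v _
    have hu' : u ∉ T := hu
    by_cases hv : v ∈ T <;> simp [crossWeights, hu', hv]
  convert h.compl ((h.compl h1).inter (h.compl h2)) using 1
  rw [Set.compl_inter, compl_compl, compl_compl, ← Set.union_inter_distrib_right,
    Set.union_compl_self, Set.univ_inter]

/-! ### Pauli strings -/

/-- The identity and the three Pauli matrices. -/
def pauli : Fin 4 → Matrix (Fin 2) (Fin 2) ℂ := ![1, pauliX, pauliY, pauliZ]

/-- A tensor product of Pauli matrices. -/
def pauliString (s : V → Fin 4) : QubitOp V := tensorOp fun u => pauli (s u)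

theorem pauli_mul_self (a : Fin 4) : pauli a * pauli a = 1 := by
  fin_cases a <;> ext i j <;> fin_cases i <;> fin_cases j <;>
    simp [pauli, pauliX, pauliY, pauliZ]

theorem trace_pauli_mul (a b : Fin 4) : (pauli a * pauli b).trace = if a = b then 2 else 0 := by
  fin_cases a <;> fin_cases b <;>
    norm_num [pauli, pauliX, pauliY, pauliZ, Matrix.trace_fin_two]

theorem pauli_conjTranspose (a : Fin 4) : (pauli a).conjTranspose = pauli a := by
  fin_cases a <;> ext i j <;> fin_cases i <;> fin_cases j <;>
    simp [pauli, pauliX, pauliY, pauliZ]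

/-- `c` is, up to a factor `± 2 i`, the commutator of `a` and `b`. -/
def LieTriple (a b c : Fin 4) : Prop :=
  ⁅pauli a, pauli b⁆ = (2 * Complex.I) • pauli c ∨ ⁅pauli b, pauli a⁆ = (2 * Complex.I) • pauli c

/-- The nonzero indices sum to 6, which is 2 in `Fin 4`, so `2 - a - b` is the third Pauli index. -/
theorem lieTriple_of_ne {a b : Fin 4} (ha : a ≠ 0) (hb : b ≠ 0) (hab : a ≠ b) :
    LieTriple a b (2 - a - b) := by
  fin_cases a <;> fin_cases b <;> simp at ha hb hab ⊢ <;>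
    simp [LieTriple, pauli, lie_pauliX_pauliY, lie_pauliY_pauliZ, lie_pauliZ_pauliX]

theorem exists_lieTriple_left {a c : Fin 4} (ha : a ≠ 0) (hc : c ≠ 0) (hac : a ≠ c) :
    ∃ b, b ≠ 0 ∧ LieTriple a b c := by
  refine ⟨2 - a - c, ?_, ?_⟩
  · decide +revert
  · have := lieTriple_of_ne (a := a) (b := 2 - a - c) ha (by decide +revert) (by decide +revert)
    convert this using 1
    clear this
    decide +revert

theorem exists_lieTriple {c : Fin 4} (hc : c ≠ 0) : ∃ a b, a ≠ 0 ∧ b ≠ 0 ∧ LieTriple a b c := by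
  obtain ⟨a, ha, hac⟩ : ∃ a : Fin 4, a ≠ 0 ∧ a ≠ c := by decide +revert
  obtain ⟨b, hb, h⟩ := exists_lieTriple_left ha hc hac
  exact ⟨a, b, ha, hb, h⟩

theorem lie_tensorOp {P Q R : V → Matrix (Fin 2) (Fin 2) ℂ} {v : V} {c : ℂ}
    (hv : ⁅P v, Q v⁆ = c • R v) (h : ∀ w, w ≠ v → P w * Q w = R w ∧ Q w * P w = R w) :
    ⁅tensorOp P, tensorOp Q⁆ = c • tensorOp R := by
  rw [LieRing.of_associative_ring_bracket, tensorOp_mul, tensorOp_mul]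
  ext x y
  have hxy := congrFun (congrFun hv (x v)) (y v)
  rw [LieRing.of_associative_ring_bracket] at hxy
  simp only [Matrix.sub_apply, Matrix.smul_apply, smul_eq_mul] at hxy
  simp only [tensorOp, Matrix.sub_apply, Matrix.of_apply, Matrix.smul_apply, smul_eq_mul]
  rw [← Finset.mul_prod_erase _ _ (Finset.mem_univ v), ← Finset.mul_prod_erase _ _
    (Finset.mem_univ v), ← Finset.mul_prod_erase _ (fun u => R u (x u) (y u)) (Finset.mem_univ v),
    Finset.prod_congr rfl fun w hw => by rw [(h w (Finset.ne_of_mem_erase hw)).1],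
    Finset.prod_congr (f := fun u => (Q u * P u) (x u) (y u)) rfl
      fun w hw => by rw [(h w (Finset.ne_of_mem_erase hw)).2],
    ← sub_mul, hxy, mul_assoc]

/-! ### Generating all Pauli strings from local rotations and edges -/

variable {g : LieSubalgebra ℝ (QubitOp V)}

/-- Away from `v` the one-qubit factors commute and multiply to the factor of `r`: one is the
identity, or they are equal and cancel. All noncommutativity sits at `v`. -/
theorem pauliString_mem_of_lieTriple {s t r : V → Fin 4} (v : V)
    (hs : Complex.I • pauliString s ∈ g) (ht : Complex.I • pauliString t ∈ g)
    (hv : LieTriple (s v) (t v) (r v))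
    (h : ∀ w, w ≠ v → s w = 0 ∧ t w = r w ∨ t w = 0 ∧ s w = r w ∨ s w = t w ∧ r w = 0) :
    Complex.I • pauliString r ∈ g := by
  have h' : ∀ w, w ≠ v → pauli (s w) * pauli (t w) = pauli (r w) ∧
      pauli (t w) * pauli (s w) = pauli (r w) := by
    intro w hw
    have h0 : pauli 0 = 1 := rfl
    rcases h w hw with ⟨h1, h2⟩ | ⟨h1, h2⟩ | ⟨h1, h2⟩
    · rw [h1, h2, h0]; simp
    · rw [h1, h2, h0]; simp
    · rw [h1, h2, h0, pauli_mul_self]; simp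
  rcases hv with hv | hv
  · exact mem_of_lie_two_I hs ht (lie_tensorOp (v := v) hv h')
  · exact mem_of_lie_two_I ht hs (lie_tensorOp (v := v) hv fun w hw => (h' w hw).symm)

theorem pauliString_single (v : V) (a : Fin 4) :
    pauliString (Pi.single v a) = opAt (pauli a) v := by
  rw [pauliString, opAt]
  congr 1
  funext w
  by_cases h : w = v
  · subst h; simp
  · simp [h, pauli]

theorem pauliString_single_mem {v : V} (h : Controls g {v}) {a : Fin 4} (ha : a ≠ 0) :
    Complex.I • pauliString (Pi.single v a) ∈ g := by
  simp only [Controls, setOp_singleton] at h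
  rw [pauliString_single]
  fin_cases a
  · exact absurd rfl ha
  · exact h.1
  · exact h.2.1
  · exact h.2.2

theorem pauliString_update_mem {v : V} (h : Controls g {v}) {s : V → Fin 4} (hsv : s v ≠ 0)
    (hs : Complex.I • pauliString s ∈ g) {c : Fin 4} (hc : c ≠ 0) :
    Complex.I • pauliString (Function.update s v c) ∈ g := by
  by_cases hsc : s v = c
  · rwa [← hsc, Function.update_eq_self]
  obtain ⟨b, hb, hT⟩ := exists_lieTriple_left hsv hc hsc
  refine pauliString_mem_of_lieTriple v hs (pauliString_single_mem h hb) (by simpa using hT) ?_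
  intro w hw
  simp [hw]

/-- All two-qubit Pauli strings on the qubits `u` and `v` are in `g`, up to a factor `i`. -/
def Linked (g : LieSubalgebra ℝ (QubitOp V)) (u v : V) : Prop :=
  ∀ a b : Fin 4, a ≠ 0 → b ≠ 0 →
    Complex.I • pauliString (Function.update (Pi.single u a) v b) ∈ g

/-- Rotate the letter at `u` to `a`, then commute with `b` at `u` times `c` at `w`: choosing `a`,
`b` with commutator proportional to the old letter restores it and leaves `c` at `w`. -/
theorem Linked.extend {u w : V} (hl : Linked g u w) (huw : u ≠ w) (hu : Controls g {u})
    {s : V → Fin 4} (hsu : s u ≠ 0) (hsw : s w = 0) (hs : Complex.I • pauliString s ∈ g)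
    {c : Fin 4} (hc : c ≠ 0) : Complex.I • pauliString (Function.update s w c) ∈ g := by
  obtain ⟨a, b, ha, hb, hT⟩ := exists_lieTriple hsu
  refine pauliString_mem_of_lieTriple u (pauliString_update_mem hu hsu hs ha) (hl b c hb hc)
    (by simpa [huw] using hT) ?_
  intro v hv
  by_cases hvw : v = w
  · subst hvw; simp [hv, hsw]
  · simp [hv, hvw]

/-- Extend a string on `u`, `v` to `w`, then commute with a string on `v`, `w` having the same
letter at `v`: the letters at `v` cancel, and the commutator at `w` gives `b`. -/
theorem Linked.trans {u v w : V} (huv : Linked g u v) (hvw : Linked g v w) (h1 : u ≠ v)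
    (h2 : v ≠ w) (h3 : u ≠ w) (hc : ∀ v, Controls g {v}) : Linked g u w := by
  intro a b ha hb
  obtain ⟨x, y, hx, hy, hT⟩ := exists_lieTriple hb
  refine pauliString_mem_of_lieTriple w
    (hvw.extend h2 (hc v) (by simp : _ ≠ (0 : Fin 4)) (by simp [h3.symm, h2.symm])
      (huv a 1 ha (by decide)) hx) (hvw 1 y (by decide) hy) (by simpa using hT) ?_
  intro z hz
  by_cases hzv : z = v
  · subst hzv; simp [hz, h1.symm]
  · by_cases hzu : z = u
    · subst hzu; simp [hz, hzv]
    · simp [hz, hzv, hzu]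

/-- The only edge crossing both `{u}` and `{v}` is `s(u, v)`, so two crossing filters isolate it. -/
theorem Controls.edgeZZ_mem {G : SimpleGraph V} {r : Sym2 V → ℝ}
    (hr : Complex.I • problemHam G r ∈ g) (hc : ∀ v, Controls g {v}) {u v : V} (h : G.Adj u v)
    (h0 : r s(u, v) ≠ 0) : Complex.I • edgeZZ s(u, v) ∈ g := by
  classical
  have hmem := g.smul_mem (r s(u, v))⁻¹ (cross_mem (hc u) (cross_mem (hc v) hr))
  convert hmem using 1
  rw [problemHam, Finset.sum_eq_single s(u, v)]
  · have : crossWeights {u} (crossWeights {v} r) s(u, v) = r s(u, v) := by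
      simp [crossWeights, h.ne, h.ne.symm]
    rw [this, smul_comm, smul_smul, inv_mul_cancel₀ h0, one_smul]
  · intro e _ hne
    have : crossWeights {u} (crossWeights {v} r) e = 0 := by
      induction e with
      | _ a b =>
        simp only [crossWeights, Sym2.mem_iff, Set.mem_singleton_iff]
        split_ifs with h1 h2
        · exfalso
          have huv := h.ne
          apply hne
          grind
        · rfl
        · rfl
    rw [this, zero_smul]
  · simp [h]

theorem pauliString_pair {u v : V} (h : u ≠ v) (a b : Fin 4) :
    pauliString (Function.update (Pi.single u a) v b) = opAt (pauli a) u * opAt (pauli b) v := by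
  rw [pauliString, opAt, opAt, tensorOp_mul]
  congr 1
  funext w
  by_cases hv : w = v
  · subst hv; simp [h.symm]
  · by_cases hu : w = u
    · subst hu; simp [hv]
    · simp [hu, hv, pauli]

theorem linked_of_adj {G : SimpleGraph V} {r : Sym2 V → ℝ}
    (hr : Complex.I • problemHam G r ∈ g) (hc : ∀ v, Controls g {v}) {u v : V} (h : G.Adj u v)
    (h0 : r s(u, v) ≠ 0) : Linked g u v := by
  intro a b ha hb
  have h1 := Controls.edgeZZ_mem hr hc h h0
  rw [edgeZZ_mk h.ne, show pauliZ = pauli 3 from rfl, ← pauliString_pair h.ne] at h1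
  have h2 := pauliString_update_mem (hc u) (by simp [h.ne]) h1 ha
  have h3 := pauliString_update_mem (hc v) (by simp [h.ne.symm]) h2 hb
  convert h3 using 3
  funext w
  by_cases hv : w = v
  · subst hv; simp
  · by_cases hu : w = u
    · subst hu; simp [hv]
    · simp [hu, hv]

theorem linked_of_connected {G : SimpleGraph V} {r : Sym2 V → ℝ} (hG : G.Connected)
    (hr : Complex.I • problemHam G r ∈ g) (hc : ∀ v, Controls g {v})
    (h0 : ∀ e ∈ G.edgeSet, r e ≠ 0) {u v : V} (h : u ≠ v) : Linked g u v := by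
  have hreach := (G.reachable_iff_reflTransGen u v).1 (hG.preconnected u v)
  induction hreach with
  | refl => exact absurd rfl h
  | @tail v w _ hvw ih =>
    have hl : Linked g v w := linked_of_adj hr hc hvw (h0 _ hvw)
    by_cases huv : u = v
    · rwa [huv]
    · exact (ih huv).trans hl huv hvw.ne h hc

/-- Start with one letter in the support of `s` and add the others one at a time; any new qubit is
linked to the starting one, so the order is immaterial. -/
theorem pauliString_mem {G : SimpleGraph V} {r : Sym2 V → ℝ} (hG : G.Connected)
    (hr : Complex.I • problemHam G r ∈ g) (hc : ∀ v, Controls g {v})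
    (h0 : ∀ e ∈ G.edgeSet, r e ≠ 0) {s : V → Fin 4} (hs : s ≠ 0) :
    Complex.I • pauliString s ∈ g := by
  classical
  obtain ⟨u, hu⟩ := Function.ne_iff.1 hs
  have key : ∀ T : Finset V, u ∉ T →
      Complex.I • pauliString (fun w => if w = u ∨ w ∈ T then s w else 0) ∈ g := by
    intro T
    induction T using Finset.induction_on with
    | empty =>
      intro _
      convert pauliString_single_mem (hc u) hu using 3
      funext w
      by_cases hw : w = u
      · subst hw; simp
      · simp [hw]
    | insert w T hw ih =>
      intro huT
      rw [Finset.mem_insert, not_or] at huT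
      have ih' := ih huT.2
      by_cases hsw : s w = 0
      · convert ih' using 3
        funext v
        by_cases hv : v = w
        · subst hv; simp [hsw]
        · simp [hv]
      · have hl := linked_of_connected hG hr hc h0 huT.1
        convert hl.extend huT.1 (hc u) (by simpa using hu) (by simp [hw, Ne.symm huT.1]) ih' hsw
          using 3
        funext v
        by_cases hv : v = w
        · subst hv; simp
        · simp [hv]
  convert key (Finset.univ.erase u) (by simp) using 3
  funext w
  by_cases hw : w = u <;> simp [hw]

/-! ### Pauli strings span the traceless skew-Hermitian matrices -/

theorem trace_pauliString_mul (s t : V → Fin 4) :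
    (pauliString s * pauliString t).trace = if s = t then 2 ^ Fintype.card V else 0 := by
  rw [pauliString, pauliString, tensorOp_mul, trace_tensorOp]
  simp only [trace_pauli_mul]
  split_ifs with h
  · simp [h]
  · obtain ⟨u, hu⟩ := Function.ne_iff.1 h
    exact Finset.prod_eq_zero (Finset.mem_univ u) (by simp [hu])

omit [DecidableEq V] in
theorem pauliString_zero : pauliString (0 : V → Fin 4) = 1 := by
  ext x y
  simp only [pauliString, tensorOp, Matrix.of_apply, Pi.zero_apply, Matrix.one_apply,
    show pauli 0 = 1 from rfl, funext_iff]
  rw [Finset.prod_ite_zero]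
  simp

theorem trace_pauliString {s : V → Fin 4} (hs : s ≠ 0) : (pauliString s).trace = 0 := by
  have := trace_pauliString_mul s 0
  rwa [pauliString_zero, mul_one, if_neg hs] at this

omit [DecidableEq V] in
theorem pauliString_conjTranspose (s : V → Fin 4) :
    (pauliString s).conjTranspose = pauliString s := by
  ext x y
  simp only [pauliString, tensorOp, Matrix.conjTranspose_apply, Matrix.of_apply, star_prod]
  refine Finset.prod_congr rfl fun u _ => ?_
  rw [← Matrix.conjTranspose_apply, pauli_conjTranspose]

theorem pauliString_mem_su {s : V → Fin 4} (hs : s ≠ 0) :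
    Complex.I • pauliString s ∈ su (V → Fin 2) := by
  refine ⟨?_, ?_⟩
  · simp [Matrix.conjTranspose_smul, pauliString_conjTranspose]
  · rw [Matrix.trace_smul, trace_pauliString hs, smul_zero]

theorem linearIndependent_pauliString :
    LinearIndependent ℂ (pauliString : (V → Fin 4) → QubitOp V) := by
  rw [Fintype.linearIndependent_iff]
  intro c hc t
  have := congrArg (fun M => (M * pauliString t).trace) hc
  simpa [Finset.sum_mul, Matrix.trace_sum, trace_pauliString_mul] using this

theorem exists_pauliString_sum (M : QubitOp V) : ∃ c : (V → Fin 4) → ℂ,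
    M = ∑ s, c s • pauliString s := by
  let b := basisOfLinearIndependentOfCardEqFinrank linearIndependent_pauliString
    (by simp [Module.finrank_matrix, ← mul_pow] : Fintype.card (V → Fin 4) =
      Module.finrank ℂ (QubitOp V))
  exact ⟨fun s => b.repr M s, by simpa [b] using (b.sum_repr M).symm⟩

/-- In the Pauli basis, whose members are Hermitian, skew-Hermitian means imaginary coefficients;
only the identity has nonzero trace, so tracelessness removes that term. -/
theorem mem_of_mem_su {W : Submodule ℝ (QubitOp V)}
    (hW : ∀ s : V → Fin 4, s ≠ 0 → Complex.I • pauliString s ∈ W) {M : QubitOp V}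
    (hM : M ∈ su (V → Fin 2)) : M ∈ W := by
  obtain ⟨c, rfl⟩ := exists_pauliString_sum M
  obtain ⟨h1, h2⟩ := hM
  refine W.sum_mem fun s _ => ?_
  have hc : star (c s) + c s = 0 := by
    refine Fintype.linearIndependent_iff.1 linearIndependent_pauliString
      (fun s => star (c s) + c s) ?_ s
    simp only [Matrix.conjTranspose_sum, Matrix.conjTranspose_smul, pauliString_conjTranspose] at h1
    simp only [add_smul, Finset.sum_add_distrib, h1, neg_add_cancel]
  by_cases hs : s = 0
  · subst hs
    have h3 : (0 : V → Fin 4) ∈ Finset.univ := Finset.mem_univ _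
    rw [Matrix.trace_sum, Finset.sum_eq_single_of_mem _ h3] at h2
    · rw [pauliString_zero, Matrix.trace_smul, Matrix.trace_one, smul_eq_mul] at h2
      have : c 0 = 0 := by simpa using h2
      rw [this, zero_smul]
      exact W.zero_mem
    · intro s _ hs
      rw [Matrix.trace_smul, trace_pauliString hs, smul_zero]
  · have : c s = (c s).im * Complex.I := by
      have hre := congrArg Complex.re hc
      simp at hre
      apply Complex.ext <;> simp
      linarith
    rw [this, mul_smul]
    exact W.smul_mem (c s).im (hW s hs)

theorem finrank_su : Module.finrank ℝ (su (V → Fin 2)) = 4 ^ Fintype.card V - 1 := by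
  have hspan : (su (V → Fin 2)).toSubmodule = Submodule.span ℝ
      (Set.range fun s : {s : V → Fin 4 // s ≠ 0} => Complex.I • pauliString s.1) := by
    refine le_antisymm (fun M hM => mem_of_mem_su (fun s hs => ?_) hM) (Submodule.span_le.2 ?_)
    · exact Submodule.subset_span ⟨⟨s, hs⟩, rfl⟩
    · rintro _ ⟨s, rfl⟩
      exact pauliString_mem_su s.2
  have hli : LinearIndependent ℝ
      fun s : {s : V → Fin 4 // s ≠ 0} => Complex.I • pauliString s.1 := by
    have h1 : LinearIndependent ℂ fun s : {s : V → Fin 4 // s ≠ 0} => pauliString s.1 :=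
      linearIndependent_pauliString.comp _ Subtype.val_injective
    rw [Fintype.linearIndependent_iff] at h1 ⊢
    intro a ha s
    have := h1 (fun s => a s * Complex.I) (by rw [← ha]; simp only [mul_smul]; rfl) s
    simpa using this
  change Module.finrank ℝ (su (V → Fin 2)).toSubmodule = _
  rw [hspan, finrank_span_eq_card hli, Fintype.card_subtype_compl]
  simp

theorem dla_le_su (G : SimpleGraph V) (r : Sym2 V → ℝ) : dla G r ≤ su (V → Fin 2) := by
  have hsum : ∀ a : Fin 4, a ≠ 0 → Complex.I • sumOp (pauli a) ∈ su (V → Fin 2) := by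
    intro a ha
    rw [sumOp, Finset.smul_sum]
    refine sum_mem fun u _ => ?_
    rw [← pauliString_single]
    exact pauliString_mem_su (by simpa using ha)
  rw [dla, LieSubalgebra.lieSpan_le]
  rintro _ (rfl | rfl | rfl)
  · exact hsum 1 (by decide)
  · exact hsum 2 (by decide)
  · rw [problemHam, Finset.smul_sum]
    refine sum_mem fun e he => ?_
    induction e with
    | _ u v =>
      have huv : u ≠ v := G.ne_of_adj (by simpa using he)
      rw [smul_comm, edgeZZ_mk huv, show pauliZ = pauli 3 from rfl, ← pauliString_pair huv]
      refine (su (V → Fin 2)).smul_mem _ (pauliString_mem_su fun h => ?_)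
      simpa using congrFun h v

theorem dla_eq_su_of_controls {G : SimpleGraph V} {r : Sym2 V → ℝ} (hG : G.Connected)
    (h0 : ∀ e ∈ G.edgeSet, r e ≠ 0) (hc : ∀ v, Controls (dla G r) {v}) :
    dla G r = su (V → Fin 2) ∧ Module.finrank ℝ (dla G r) = 4 ^ Fintype.card V - 1 := by
  have h : dla G r = su (V → Fin 2) := le_antisymm (dla_le_su G r) fun M hM =>
    mem_of_mem_su (W := (dla G r).toSubmodule)
      (fun s hs => pauliString_mem hG (problemHam_mem_dla G r) hc h0 hs) hM
  exact ⟨h, by rw [h, finrank_su]⟩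

end

/-! ### Graphs whose vertices are separated by neighbourhood parities -/

/-- A Boolean algebra of vertex sets that is closed under passing from `T` to the set of vertices
with an odd number of neighbours in `T`. -/
structure ParityClosed {V : Type*} (G : SimpleGraph V) (𝒢 : Set (Set V)) : Prop where
  univ_mem : Set.univ ∈ 𝒢
  inter_mem : ∀ {S T}, S ∈ 𝒢 → T ∈ 𝒢 → S ∩ T ∈ 𝒢
  compl_mem : ∀ {S}, S ∈ 𝒢 → Sᶜ ∈ 𝒢
  oddNbrs_mem : ∀ {S}, S ∈ 𝒢 → oddNbrs G S ∈ 𝒢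

/-- Every parity-closed family contains all singletons. -/
def ParityDiscrete {V : Type*} (G : SimpleGraph V) : Prop :=
  ∀ 𝒢, ParityClosed G 𝒢 → ∀ u, {u} ∈ 𝒢

theorem oddNbrs_singleton {V : Type*} (G : SimpleGraph V) (u : V) :
    oddNbrs G {u} = G.neighborSet u := by
  ext v
  simp only [oddNbrs, Set.mem_ofPred_eq, SimpleGraph.mem_neighborSet]
  by_cases h : G.Adj v u
  · rw [Set.inter_eq_right.2 (by simpa using h)]
    simp [h.symm]
  · rw [Set.inter_singleton_eq_empty.2 (by simpa using h)]
    simpa [G.adj_comm] using h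

theorem ParityDiscrete.of_iso {V W : Type*} {H : SimpleGraph V} {K : SimpleGraph W} (f : H ≃g K)
    (hK : ParityDiscrete K) : ParityDiscrete H := by
  intro 𝒢 h u
  have hodd : ∀ S, f ⁻¹' oddNbrs K S = oddNbrs H (f ⁻¹' S) := by
    intro S
    ext v
    have : K.neighborSet (f v) ∩ S = f '' (H.neighborSet v ∩ f ⁻¹' S) := by
      ext w
      obtain ⟨w, rfl⟩ := f.surjective w
      simp [f.map_adj_iff]
    simp only [oddNbrs, Set.mem_preimage, Set.mem_ofPred_eq, this,
      Set.ncard_image_of_injective _ f.injective]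
  have hcl : ParityClosed K {S | f ⁻¹' S ∈ 𝒢} :=
    { univ_mem := h.univ_mem
      inter_mem := fun hS hT => h.inter_mem hS hT
      compl_mem := fun hS => h.compl_mem hS
      oddNbrs_mem := fun {S} hS => by
        rw [Set.mem_ofPred_eq, hodd]
        exact h.oddNbrs_mem hS }
  have := hK _ hcl (f u)
  rw [Set.mem_ofPred_eq] at this
  convert this using 1
  ext w
  simp

/-- The bridge from Lie algebra to combinatorics: from here on only the graph matters in the
unweighted case. -/
theorem parityClosed_controls {V : Type*} [Fintype V] [DecidableEq V] (G : SimpleGraph V) :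
    ParityClosed G {S | Controls (dla G fun _ => 1) S} where
  univ_mem := controls_univ_dla G _
  inter_mem hS hT := hS.inter hT
  compl_mem hS := (controls_univ_dla G _).compl hS
  oddNbrs_mem hS := Controls.oddNbrs (problemHam_mem_dla G _) (controls_univ_dla G _) hS

theorem ParityDiscrete.dla_eq_su {V : Type*} [Fintype V] [DecidableEq V] {G : SimpleGraph V}
    (h : ParityDiscrete G) (hG : G.Connected) : dla G (fun _ => 1) = su (V → Fin 2) ∧
      Module.finrank ℝ (dla G fun _ => 1) = 4 ^ Fintype.card V - 1 :=
  dla_eq_su_of_controls hG (fun _ _ => one_ne_zero) (h _ (parityClosed_controls G))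

/-! ### Subdivisions -/

namespace Subdivision

variable {V : Type*} {G : SimpleGraph V} {src dst : G.edgeSet → V} {len : G.edgeSet → ℕ}

variable (src dst len) in
/-- The `i`-th vertex on the path that replaces the edge `e`, from `src e` for `i = 0` to `dst e`
for `i = len e + 1`. -/
def pos (e : G.edgeSet) (i : ℕ) : SubdivVertex G len :=
  if i = 0 then Sum.inl (src e)
  else if h : i - 1 < len e then Sum.inr ⟨e, ⟨i - 1, h⟩⟩ else Sum.inl (dst e)

theorem pos_zero (e : G.edgeSet) : pos src dst len e 0 = Sum.inl (src e) := by simp [pos]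

theorem pos_succ (e : G.edgeSet) {j : ℕ} (h : j < len e) :
    pos src dst len e (j + 1) = Sum.inr ⟨e, ⟨j, h⟩⟩ := by simp [pos, h]

theorem pos_last (e : G.edgeSet) {i : ℕ} (h : len e < i) :
    pos src dst len e i = Sum.inl (dst e) := by
  have h1 : i ≠ 0 := by omega
  have h2 : ¬ i - 1 < len e := by omega
  simp [pos, h1, h2]

theorem pos_eq_inr {e e' : G.edgeSet} {i : ℕ} {j : Fin (len e)} :
    pos src dst len e' i = Sum.inr ⟨e, j⟩ ↔ e' = e ∧ i = j + 1 := by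
  constructor
  · intro h
    rw [pos] at h
    split_ifs at h with h1 h2
    simp only [Sum.inr.injEq, Sigma.mk.injEq] at h
    obtain ⟨rfl, h⟩ := h
    have := congrArg Fin.val (eq_of_heq h)
    simp only at this
    exact ⟨rfl, by omega⟩
  · rintro ⟨rfl, rfl⟩
    exact pos_succ _ j.2

theorem pos_eq_inl {e : G.edgeSet} {i : ℕ} {v : V} :
    pos src dst len e i = Sum.inl v ↔ i = 0 ∧ src e = v ∨ len e < i ∧ dst e = v := by
  rcases Nat.eq_zero_or_pos i with rfl | hi
  · simp [pos_zero]
  · by_cases h : len e < i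
    · simp [pos_last e h, h, hi.ne']
    · obtain ⟨j, rfl⟩ := Nat.exists_eq_add_of_le' hi
      rw [pos_succ e (by omega)]
      simp [h]

theorem subdivRel_iff {x y : SubdivVertex G len} : SubdivRel G src dst len x y ↔
    ∃ e i, i ≤ len e ∧ x = pos src dst len e i ∧ y = pos src dst len e (i + 1) := by
  constructor
  · rintro (⟨e, h⟩ | ⟨e, h⟩ | ⟨e, j, h⟩ | ⟨e, h⟩)
    · exact ⟨e, 0, Nat.zero_le _, (pos_zero e).symm, (pos_last e (by omega)).symm⟩
    · exact ⟨e, 0, Nat.zero_le _, (pos_zero e).symm, (pos_succ e h).symm⟩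
    · exact ⟨e, j + 1, h.le, (pos_succ e _).symm, (pos_succ e h).symm⟩
    · refine ⟨e, len e, le_rfl, ?_, (pos_last e (by omega)).symm⟩
      rw [eq_comm, pos_eq_inr]
      exact ⟨rfl, by simp only; omega⟩
  · rintro ⟨e, i, hi, rfl, rfl⟩
    rcases Nat.eq_zero_or_pos i with rfl | h0
    · rcases Nat.eq_zero_or_pos (len e) with h | h
      · rw [pos_zero, pos_last e (by omega)]
        exact .keep e h
      · rw [pos_zero, pos_succ e h]
        exact .first e h
    · obtain ⟨j, rfl⟩ := Nat.exists_eq_add_of_le' h0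
      rw [pos_succ e (by omega)]
      rcases hi.lt_or_eq with h | h
      · rw [pos_succ e h]
        exact .step e j h
      · rw [pos_last e (by omega)]
        have := SubdivRel.last (G := G) (src := src) (dst := dst) (len := len) e (by omega)
        convert this using 4
        omega

/-- The path vertices whose edge and position satisfy `q`. -/
def onPaths (q : G.edgeSet → ℕ → Prop) : Set (SubdivVertex G len) :=
  {x | Sum.elim (fun _ => False) (fun p => q p.1 p.2) x}

theorem inl_mem_onPaths (q : G.edgeSet → ℕ → Prop) (v : V) :
    (Sum.inl v : SubdivVertex G len) ∈ onPaths q ↔ False := Iff.rfl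

theorem inr_mem_onPaths (q : G.edgeSet → ℕ → Prop) (e : G.edgeSet) (j : Fin (len e)) :
    (Sum.inr ⟨e, j⟩ : SubdivVertex G len) ∈ onPaths q ↔ q e j := Iff.rfl

theorem pos_mem_onPaths (q : G.edgeSet → ℕ → Prop) (e : G.edgeSet) (i : ℕ) :
    pos src dst len e i ∈ onPaths q ↔ 1 ≤ i ∧ i ≤ len e ∧ q e (i - 1) := by
  rcases Nat.eq_zero_or_pos i with rfl | h0
  · simp [pos_zero, inl_mem_onPaths]
  · obtain ⟨j, rfl⟩ := Nat.exists_eq_add_of_le' h0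
    by_cases h : j < len e
    · rw [pos_succ e h, inr_mem_onPaths]
      simp [Nat.succ_le_of_lt h]
    · rw [pos_last e (by omega), inl_mem_onPaths, false_iff]
      rintro ⟨-, h2, -⟩
      omega

variable (hsd : ∀ e : G.edgeSet, s(src e, dst e) = (e : Sym2 V))
include hsd

theorem src_ne_dst (e : G.edgeSet) : src e ≠ dst e := by
  have h := e.2
  rw [← hsd e] at h
  exact G.ne_of_adj h

theorem mem_edge_iff (e : G.edgeSet) (v : V) : v ∈ (e : Sym2 V) ↔ v = src e ∨ v = dst e := by
  rw [← hsd e, Sym2.mem_iff]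

theorem pos_inj {e : G.edgeSet} {i j : ℕ} (hi : i ≤ len e + 1) (hj : j ≤ len e + 1)
    (h : pos src dst len e i = pos src dst len e j) : i = j := by
  have hne := src_ne_dst hsd e
  rcases Nat.eq_zero_or_pos i with rfl | h0
  · rw [pos_zero, eq_comm, pos_eq_inl] at h
    rcases h with h | h
    · exact h.1.symm
    · exact absurd h.2.symm hne
  · obtain ⟨i, rfl⟩ := Nat.exists_eq_add_of_le' h0
    by_cases hi' : i < len e
    · rw [pos_succ e hi', eq_comm, pos_eq_inr] at h
      exact h.2.symm
    · rw [pos_last e (by omega), eq_comm, pos_eq_inl] at h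
      rcases h with h | h
      · exact absurd h.2 hne
      · omega

theorem adj_iff {x y : SubdivVertex G len} : (subdivision G src dst len).Adj x y ↔
    ∃ e i, i ≤ len e ∧ (x = pos src dst len e i ∧ y = pos src dst len e (i + 1) ∨
      y = pos src dst len e i ∧ x = pos src dst len e (i + 1)) := by
  rw [subdivision, SimpleGraph.fromRel_adj, subdivRel_iff, subdivRel_iff]
  constructor
  · rintro ⟨-, ⟨e, i, hi, h⟩ | ⟨e, i, hi, h⟩⟩
    · exact ⟨e, i, hi, Or.inl h⟩
    · exact ⟨e, i, hi, Or.inr h⟩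
  · rintro ⟨e, i, hi, ⟨rfl, rfl⟩ | ⟨rfl, rfl⟩⟩
    · refine ⟨fun h => ?_, Or.inl ⟨e, i, hi, rfl, rfl⟩⟩
      have := pos_inj hsd (by omega) (by omega) h
      omega
    · refine ⟨fun h => ?_, Or.inr ⟨e, i, hi, rfl, rfl⟩⟩
      have := pos_inj hsd (by omega) (by omega) h
      omega

theorem neighborSet_inr (e : G.edgeSet) (j : Fin (len e)) :
    (subdivision G src dst len).neighborSet (Sum.inr ⟨e, j⟩) =
      {pos src dst len e j, pos src dst len e (j + 2)} := by
  ext y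
  rw [SimpleGraph.mem_neighborSet, adj_iff hsd, Set.mem_insert_iff, Set.mem_singleton_iff]
  constructor
  · rintro ⟨e', i, hi, ⟨h, rfl⟩ | ⟨rfl, h⟩⟩
    · obtain ⟨rfl, rfl⟩ := pos_eq_inr.1 h.symm
      exact Or.inr rfl
    · obtain ⟨rfl, h⟩ := pos_eq_inr.1 h.symm
      exact Or.inl (by rw [Nat.succ_injective h])
  · rintro (rfl | rfl)
    · exact ⟨e, j, j.2.le, Or.inr ⟨rfl, (pos_succ e j.2).symm⟩⟩
    · exact ⟨e, j + 1, j.2, Or.inl ⟨(pos_succ e j.2).symm, rfl⟩⟩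

theorem inr_mem_oddNbrs (T : Set (SubdivVertex G len)) (e : G.edgeSet) (j : Fin (len e)) :
    Sum.inr ⟨e, j⟩ ∈ oddNbrs (subdivision G src dst len) T ↔
      ¬ (pos src dst len e j ∈ T ↔ pos src dst len e (j + 2) ∈ T) := by
  have hne : pos src dst len e j ≠ pos src dst len e (j + 2) := fun h => by
    have := pos_inj hsd (by omega) (by omega) h
    omega
  rw [oddNbrs, Set.mem_ofPred_eq, neighborSet_inr hsd, Set.insert_eq, Set.union_inter_distrib_right]
  by_cases h1 : pos src dst len e j ∈ T <;> by_cases h2 : pos src dst len e (j + 2) ∈ T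
  · rw [Set.inter_eq_left.2 (Set.singleton_subset_iff.2 h1),
      Set.inter_eq_left.2 (Set.singleton_subset_iff.2 h2), ← Set.insert_eq, Set.ncard_pair hne]
    simp [h1, h2]
  · simp [h1, h2]
  · simp [h1, h2]
  · simp [h1, h2]

omit hsd in
open Classical in
variable (src dst len) in
/-- The neighbour of the original vertex `v` on the path that replaces `e`. -/
def nb (v : V) (e : G.edgeSet) : SubdivVertex G len :=
  if v = src e then pos src dst len e 1 else pos src dst len e (len e)

theorem adj_inl_iff {v : V} {y : SubdivVertex G len} :
    (subdivision G src dst len).Adj (Sum.inl v) y ↔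
      ∃ e : G.edgeSet, v ∈ (e : Sym2 V) ∧ y = nb src dst len v e := by
  rw [adj_iff hsd]
  constructor
  · rintro ⟨e, i, hi, ⟨h, rfl⟩ | ⟨rfl, h⟩⟩
    · rcases pos_eq_inl.1 h.symm with ⟨rfl, rfl⟩ | ⟨h', -⟩
      · exact ⟨e, (mem_edge_iff hsd e _).2 (Or.inl rfl), by simp [nb]⟩
      · omega
    · rcases pos_eq_inl.1 h.symm with ⟨h', -⟩ | ⟨h', rfl⟩
      · omega
      · refine ⟨e, (mem_edge_iff hsd e _).2 (Or.inr rfl), ?_⟩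
        rw [nb, if_neg (src_ne_dst hsd e).symm, show i = len e by omega]
  · rintro ⟨e, hv, rfl⟩
    rcases (mem_edge_iff hsd e _).1 hv with rfl | rfl
    · exact ⟨e, 0, Nat.zero_le _, Or.inl ⟨(pos_zero e).symm, by simp [nb]⟩⟩
    · refine ⟨e, len e, le_rfl, Or.inr ⟨?_, (pos_last e (by omega)).symm⟩⟩
      rw [nb, if_neg (src_ne_dst hsd e).symm]

/-- A neighbour inside a path records its edge; across an unsubdivided edge it is the other end,
which together with `v` determines the edge. -/
theorem nb_injOn (v : V) : Set.InjOn (nb src dst len v) {e | v ∈ (e : Sym2 V)} := by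
  intro e he e' he' h
  have key : ∀ e : G.edgeSet, v ∈ (e : Sym2 V) →
      (∃ j, nb src dst len v e = Sum.inr ⟨e, j⟩) ∨
        ∃ w, nb src dst len v e = Sum.inl w ∧ (e : Sym2 V) = s(v, w) := by
    intro e he
    rcases Nat.eq_zero_or_pos (len e) with h0 | h0
    · right
      rcases (mem_edge_iff hsd e v).1 he with rfl | rfl
      · exact ⟨dst e, by simp [nb, pos_last e (show len e < 1 by omega)], (hsd e).symm⟩
      · exact ⟨src e, by
          simp [nb, h0, pos_zero, (src_ne_dst hsd e).symm], by rw [← hsd e, Sym2.eq_swap]⟩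
    · left
      rw [nb]
      split_ifs
      · exact ⟨⟨0, h0⟩, pos_succ e h0⟩
      · refine ⟨⟨len e - 1, by omega⟩, ?_⟩
        rw [pos_eq_inr]
        exact ⟨rfl, by simp only; omega⟩
  rcases key e he with ⟨j, hj⟩ | ⟨w, hw, hew⟩ <;> rcases key e' he' with ⟨j', hj'⟩ | ⟨w', hw', hew'⟩
  · rw [hj, hj'] at h
    exact (Sigma.mk.inj (Sum.inr_injective h)).1
  · rw [hj, hw'] at h
    exact absurd h (by simp)
  · rw [hw, hj'] at h
    exact absurd h (by simp)
  · rw [hw, hw'] at h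
    apply Subtype.ext
    rw [hew, hew', Sum.inl_injective h]

theorem inl_mem_oddNbrs (T : Set (SubdivVertex G len)) (v : V) :
    Sum.inl v ∈ oddNbrs (subdivision G src dst len) T ↔
      Odd {e : G.edgeSet | v ∈ (e : Sym2 V) ∧ nb src dst len v e ∈ T}.ncard := by
  rw [oddNbrs, Set.mem_ofPred_eq]
  have : (subdivision G src dst len).neighborSet (Sum.inl v) ∩ T =
      nb src dst len v '' {e | v ∈ (e : Sym2 V) ∧ nb src dst len v e ∈ T} := by
    ext y
    rw [Set.mem_inter_iff, SimpleGraph.mem_neighborSet, adj_inl_iff hsd]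
    constructor
    · rintro ⟨⟨e, he, rfl⟩, hT⟩
      exact ⟨e, ⟨he, hT⟩, rfl⟩
    · rintro ⟨e, ⟨he, hT⟩, rfl⟩
      exact ⟨⟨e, he, rfl⟩, hT⟩
  rw [this, Set.InjOn.ncard_image]
  exact (nb_injOn hsd v).mono fun e he => he.1

theorem nb_mem_onPaths (q : G.edgeSet → ℕ → Prop) {e : G.edgeSet} {v : V}
    (hv : v ∈ (e : Sym2 V)) : nb src dst len v e ∈ onPaths q ↔
      1 ≤ len e ∧ (v = src e ∧ q e 0 ∨ v = dst e ∧ q e (len e - 1)) := by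
  have hne := src_ne_dst hsd e
  rcases (mem_edge_iff hsd e v).1 hv with rfl | rfl
  · simp [nb, pos_mem_onPaths, hne]
  · simp [nb, pos_mem_onPaths, hne.symm]

omit hsd in
theorem ncard_incident (v : V) :
    {e : G.edgeSet | v ∈ (e : Sym2 V)}.ncard = (G.neighborSet v).ncard := by
  classical
  rw [← Set.ncard_image_of_injective _ Subtype.val_injective]
  have : Subtype.val '' {e : G.edgeSet | v ∈ (e : Sym2 V)} = G.incidenceSet v := by
    ext e
    constructor
    · rintro ⟨e, he, rfl⟩
      exact ⟨e.2, he⟩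
    · rintro ⟨h1, h2⟩
      exact ⟨⟨e, h1⟩, h2, rfl⟩
  rw [this]
  exact Nat.card_congr (G.incidenceSetEquivNeighborSet v)

theorem connected (hG : G.Connected) : (subdivision G src dst len).Connected := by
  have hpos : ∀ e i, i ≤ len e + 1 →
      (subdivision G src dst len).Reachable (pos src dst len e 0) (pos src dst len e i) := by
    intro e i
    induction i with
    | zero => intro _; rfl
    | succ i ih =>
      intro hi
      refine (ih (by omega)).trans (SimpleGraph.Adj.reachable ?_)
      exact (adj_iff hsd).2 ⟨e, i, by omega, Or.inl ⟨rfl, rfl⟩⟩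
  have hends : ∀ e : G.edgeSet, (subdivision G src dst len).Reachable (Sum.inl (src e))
      (Sum.inl (dst e)) := by
    intro e
    have := hpos e (len e + 1) le_rfl
    rwa [pos_zero, pos_last e (by omega)] at this
  have hadj : ∀ v w, G.Adj v w →
      (subdivision G src dst len).Reachable (Sum.inl v) (Sum.inl w) := by
    intro v w h
    have h1 := hends ⟨s(v, w), h⟩
    have h2 := hsd ⟨s(v, w), h⟩
    rcases Sym2.eq_iff.1 h2 with ⟨h3, h4⟩ | ⟨h3, h4⟩
    · rwa [h3, h4] at h1
    · rw [h3, h4] at h1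
      exact h1.symm
  have hinl : ∀ v w, (subdivision G src dst len).Reachable (Sum.inl v) (Sum.inl w) := by
    intro v w
    have := (G.reachable_iff_reflTransGen v w).1 (hG.preconnected v w)
    induction this with
    | refl => rfl
    | tail _ h ih => exact ih.trans (hadj _ _ h)
  obtain ⟨v₀⟩ := hG.nonempty
  have hall : ∀ x, (subdivision G src dst len).Reachable (Sum.inl v₀) x := by
    rintro (v | ⟨e, j⟩)
    · exact hinl v₀ v
    · have := hpos e (j + 1) (by omega)
      rw [pos_zero, pos_succ e j.2] at this
      exact (hinl _ _).trans this
  have : Nonempty (SubdivVertex G len) := ⟨Sum.inl v₀⟩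
  exact ⟨fun x y => (hall x).symm.trans (hall y)⟩

end Subdivision

section

namespace Subdivision

variable {V : Type*} {G : SimpleGraph V} {src dst : G.edgeSet → V} {len : G.edgeSet → ℕ}

/-! ### Separating the vertices of a subdivided odd graph -/

theorem onPaths_congr {q q' : G.edgeSet → ℕ → Prop} (h : ∀ e, ∀ j < len e, q e j ↔ q' e j) :
    (onPaths q : Set (SubdivVertex G len)) = onPaths q' := by
  ext x
  rcases x with v | ⟨e, j⟩
  · rfl
  · exact h e j j.2

variable (hsd : ∀ e : G.edgeSet, s(src e, dst e) = (e : Sym2 V))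
include hsd

theorem oddNbrs_onPaths_inter (q q' : G.edgeSet → ℕ → Prop) :
    oddNbrs (subdivision G src dst len) (onPaths q) ∩ onPaths q' =
      onPaths fun e j => ¬ (1 ≤ j ∧ q e (j - 1) ↔ j + 1 < len e ∧ q e (j + 1)) ∧ q' e j := by
  ext x
  rcases x with v | ⟨e, j⟩
  · simp [inl_mem_onPaths]
  · have h1 : (j : ℕ) ≤ len e := j.2.le
    rw [Set.mem_inter_iff, inr_mem_onPaths, inr_mem_onPaths, inr_mem_oddNbrs hsd, pos_mem_onPaths,
      pos_mem_onPaths]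
    simp [h1, Nat.succ_le_iff]

/-- The hypothesis says that, among all first and last path vertices, exactly those on `e` are
selected. An end of `e` therefore sees one selected vertex, and any other original vertex sees none.
-/
theorem oddNbrs_onPaths_inter_inl (q : G.edgeSet → ℕ → Prop) (e : G.edgeSet) (he : 1 ≤ len e)
    (hq : ∀ e', 1 ≤ len e' → (q e' 0 ↔ e' = e) ∧ (q e' (len e' - 1) ↔ e' = e)) :
    oddNbrs (subdivision G src dst len) (onPaths q) ∩ Set.range Sum.inl =
      Sum.inl '' {v | v ∈ (e : Sym2 V)} := by
  ext x
  rcases x with v | ⟨e', j⟩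
  · rw [Set.mem_inter_iff, inl_mem_oddNbrs hsd]
    have : {e' : G.edgeSet | v ∈ (e' : Sym2 V) ∧ nb src dst len v e' ∈ onPaths q} =
        {e' | v ∈ (e : Sym2 V) ∧ e' = e} := by
      ext e'
      constructor
      · rintro ⟨hv, hq'⟩
        rw [nb_mem_onPaths hsd q hv] at hq'
        obtain ⟨h1, h2⟩ := hq'
        have : e' = e := by
          rcases h2 with h2 | h2
          · exact (hq e' h1).1.1 h2.2
          · exact (hq e' h1).2.1 h2.2
        subst this
        exact ⟨hv, rfl⟩
      · rintro ⟨hv, rfl⟩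
        refine ⟨hv, (nb_mem_onPaths hsd q hv).2 ⟨he, ?_⟩⟩
        rcases (mem_edge_iff hsd e' v).1 hv with h | h
        · exact Or.inl ⟨h, (hq e' he).1.2 rfl⟩
        · exact Or.inr ⟨h, (hq e' he).2.2 rfl⟩
    rw [this]
    by_cases hv : v ∈ (e : Sym2 V) <;> simp [hv]
  · simp

variable {𝒢 : Set (Set (SubdivVertex G len))}
  (h𝒢 : ParityClosed (subdivision G src dst len) 𝒢) (hodd : ∀ v, Odd (G.neighborSet v).ncard)
include h𝒢 hodd

/-- These are the vertices of odd degree: original degrees are unchanged by subdivision, and path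
vertices have degree two. -/
theorem range_inl_mem : Set.range Sum.inl ∈ 𝒢 := by
  convert h𝒢.oddNbrs_mem h𝒢.univ_mem using 1
  ext x
  rcases x with v | ⟨e, j⟩
  · rw [inl_mem_oddNbrs hsd]
    simp [ncard_incident, hodd v]
  · rw [inr_mem_oddNbrs hsd]
    simp

theorem onPaths_true_mem : onPaths (fun _ _ => True) ∈ 𝒢 := by
  convert h𝒢.compl_mem (range_inl_mem hsd h𝒢 hodd) using 1
  ext x
  rcases x with v | ⟨e, j⟩
  · simp [inl_mem_onPaths]
  · simp [inr_mem_onPaths]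

omit hsd hodd in
theorem onPaths_and_mem {q q' : G.edgeSet → ℕ → Prop} (hq : onPaths q ∈ 𝒢) (hq' : onPaths q' ∈ 𝒢) :
    onPaths (fun e j => q e j ∧ q' e j) ∈ 𝒢 := by
  convert h𝒢.inter_mem hq hq' using 1
  ext x
  rcases x with v | ⟨e, j⟩
  · simp [inl_mem_onPaths]
  · rfl

theorem onPaths_not_mem {q : G.edgeSet → ℕ → Prop} (hq : onPaths q ∈ 𝒢) :
    onPaths (fun e j => ¬ q e j) ∈ 𝒢 := by
  convert h𝒢.inter_mem (h𝒢.compl_mem hq) (onPaths_true_mem hsd h𝒢 hodd) using 1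
  ext x
  rcases x with v | ⟨e, j⟩
  · simp [inl_mem_onPaths]
  · simp [inr_mem_onPaths]

omit hodd in
theorem onPaths_odd_mem {q q' : G.edgeSet → ℕ → Prop} (hq : onPaths q ∈ 𝒢)
    (hq' : onPaths q' ∈ 𝒢) {r : G.edgeSet → ℕ → Prop}
    (h : ∀ e, ∀ j < len e, r e j ↔
      ¬ (1 ≤ j ∧ q e (j - 1) ↔ j + 1 < len e ∧ q e (j + 1)) ∧ q' e j) : onPaths r ∈ 𝒢 := by
  rw [onPaths_congr h, ← oddNbrs_onPaths_inter hsd]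
  exact h𝒢.inter_mem (h𝒢.oddNbrs_mem hq) hq'

/-- The path vertices at distance `k` from the closer end of their path, except the middle ones, and
those at distance at most `k`. -/
theorem layers_mem (k : ℕ) :
    onPaths (fun e j => (j = k ∨ j + k + 1 = len e) ∧ 2 * k + 2 ≤ len e) ∈ 𝒢 ∧
      onPaths (fun e j => (j ≤ k ∨ len e ≤ j + k + 1) ∧ 2 * j + 1 ≠ len e) ∈ 𝒢 := by
  induction k with
  | zero =>
    have h0 : onPaths (fun e j => (j = 0 ∨ j + 0 + 1 = len e) ∧ 2 * 0 + 2 ≤ len e) ∈ 𝒢 := by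
      convert h𝒢.inter_mem (h𝒢.oddNbrs_mem (range_inl_mem hsd h𝒢 hodd))
        (onPaths_true_mem hsd h𝒢 hodd) using 1
      ext x
      rcases x with v | ⟨e, j⟩
      · simp [inl_mem_onPaths]
      · have h1 : ∀ i, pos src dst len e i ∈ Set.range Sum.inl ↔ i = 0 ∨ len e < i := by
          intro i
          constructor
          · rintro ⟨v, hv⟩
            rcases pos_eq_inl.1 hv.symm with h | h
            · exact Or.inl h.1
            · exact Or.inr h.1
          · rintro (rfl | h)
            · exact ⟨_, (pos_zero e).symm⟩
            · exact ⟨_, (pos_last e h).symm⟩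
        rw [Set.mem_inter_iff, inr_mem_onPaths, inr_mem_onPaths, inr_mem_oddNbrs hsd, h1, h1]
        have := j.2
        simp only [and_true]
        omega
    refine ⟨h0, ?_⟩
    rw [onPaths_congr (q' := fun e j => (j = 0 ∨ j + 0 + 1 = len e) ∧ 2 * 0 + 2 ≤ len e)]
    · exact h0
    · intro e j hj
      omega
  | succ k ih =>
    have h1 : onPaths (fun e j => (j = k + 1 ∨ j + (k + 1) + 1 = len e) ∧
        2 * (k + 1) + 2 ≤ len e) ∈ 𝒢 := by
      -- The next layer consists of the neighbours of layer `k` outside the layers already found. A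
      -- middle vertex hears from both sides at once, so parity excludes it.
      refine onPaths_odd_mem hsd h𝒢 ih.1 (onPaths_not_mem hsd h𝒢 hodd ih.2) fun e j hj => ?_
      omega
    refine ⟨h1, ?_⟩
    have h2 := onPaths_not_mem hsd h𝒢 hodd (onPaths_and_mem h𝒢
      (onPaths_not_mem hsd h𝒢 hodd ih.2) (onPaths_not_mem hsd h𝒢 hodd h1))
    rw [onPaths_congr fun e j hj => ?_]
    · exact h2
    · omega

/-- After as many layers as the longest path has vertices, the middle vertices of odd paths are all
that is left. -/
theorem middle_mem [Finite V] : onPaths (fun e j => 2 * j + 1 = len e) ∈ 𝒢 := by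
  obtain ⟨K, hK⟩ := (Set.finite_range len).bddAbove
  have h := onPaths_not_mem hsd h𝒢 hodd (layers_mem hsd h𝒢 hodd K).2
  rw [onPaths_congr fun e j hj => ?_]
  · exact h
  · have : len e ≤ K := hK ⟨e, rfl⟩
    omega

variable (hlen : Set.InjOn len {e | 1 ≤ len e})
include hlen

/-- Induction on the gap `d` between the two vertices. The length of a path is detected where its
layers meet; injectivity of `len` turns it into the edge `e`, and the selection then travels back
towards the ends. -/
theorem pair_mem [Finite V] (e : G.edgeSet) (d k : ℕ) (hk : 2 * k + 2 + d = len e) :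
    onPaths (fun e' j => e' = e ∧ (j = k ∨ j + k + 1 = len e')) ∈ 𝒢 := by
  have hE := (layers_mem hsd h𝒢 hodd k).1
  have hinj : ∀ e', 2 * k + 2 ≤ len e' → (e' = e ↔ len e' = len e) := fun e' he' =>
    ⟨fun h => by rw [h], fun h => hlen (show 1 ≤ len e' by omega) (show 1 ≤ len e by omega) h⟩
  induction d using Nat.strong_induction_on generalizing k with
  | _ d ih =>
    match d with
    | 0 =>
      -- With no gap the two vertices are adjacent; on longer paths the vertices of layer `k` are
      -- not adjacent to each other.
      refine onPaths_odd_mem hsd h𝒢 hE hE fun e' j hj => ?_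
      by_cases h : 2 * k + 2 ≤ len e'
      · rw [hinj e' h]
        omega
      · have : e' ≠ e := by rintro rfl; omega
        simp only [this, false_and, false_iff]
        omega
    | 1 =>
      -- With a gap of one, the pair consists of the neighbours of the middle vertex; on other
      -- lengths the middle is not next to layer `k`.
      refine onPaths_odd_mem hsd h𝒢 (middle_mem hsd h𝒢 hodd) hE fun e' j hj => ?_
      by_cases h : 2 * k + 2 ≤ len e'
      · rw [hinj e' h]
        omega
      · have : e' ≠ e := by rintro rfl; omega
        simp only [this, false_and, false_iff]
        omega
    | d + 2 =>
      have h1 := ih d (by omega) (k + 1) (by omega) (layers_mem hsd h𝒢 hodd (k + 1)).1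
        fun e' he' => hinj e' (by omega)
      refine onPaths_odd_mem hsd h𝒢 h1 hE fun e' j hj => ?_
      by_cases h : e' = e
      · subst h
        simp only [true_and]
        omega
      · simp [h]

theorem ends_mem [Finite V] (e : G.edgeSet) (he : 1 ≤ len e) :
    Sum.inl '' {v | v ∈ (e : Sym2 V)} ∈ 𝒢 := by
  have hO := range_inl_mem hsd h𝒢 hodd
  rcases he.eq_or_lt with h1 | h1
  · rw [← oddNbrs_onPaths_inter_inl hsd (fun e j => 2 * j + 1 = len e) e he]
    · exact h𝒢.inter_mem (h𝒢.oddNbrs_mem (middle_mem hsd h𝒢 hodd)) hO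
    · intro e' he'
      have : e' = e ↔ len e' = len e := ⟨fun h => by rw [h], fun h => hlen he' he h⟩
      rw [this]
      omega
  · rw [← oddNbrs_onPaths_inter_inl hsd
      (fun e' j => e' = e ∧ (j = 0 ∨ j + 0 + 1 = len e')) e he]
    · exact h𝒢.inter_mem (h𝒢.oddNbrs_mem (pair_mem hsd h𝒢 hodd hlen e (len e - 2) 0 (by omega))) hO
    · intro e' he'
      constructor
      · simp
      · rw [and_iff_left]
        omega

variable (hkeep : {e | len e = 0}.Subsingleton)
include hkeep

/-- Odd and not 1 means degree at least three, so two subdivided edges meet at `v`; in a simple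
graph their end pairs have only `v` in common. -/
theorem singleton_inl_mem_of_ncard [Finite V] {v : V} (hv : (G.neighborSet v).ncard ≠ 1) :
    {Sum.inl v} ∈ 𝒢 := by
  have h3 : 3 ≤ {e : G.edgeSet | v ∈ (e : Sym2 V)}.ncard := by
    rw [ncard_incident]
    obtain ⟨m, hm⟩ := hodd v
    omega
  have h2 : 1 < ({e : G.edgeSet | v ∈ (e : Sym2 V)} \ {e | len e = 0}).ncard := by
    have h4 := Set.le_ncard_sdiff {e | len e = 0} {e : G.edgeSet | v ∈ (e : Sym2 V)}
    have h5 := Set.ncard_le_one_iff_subsingleton.2 hkeep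
    omega
  obtain ⟨e, e', ⟨he, hle⟩, ⟨he', hle'⟩, hne⟩ := (Set.one_lt_ncard_iff).1 h2
  have := h𝒢.inter_mem (ends_mem hsd h𝒢 hodd hlen e (Nat.one_le_iff_ne_zero.2 hle))
    (ends_mem hsd h𝒢 hodd hlen e' (Nat.one_le_iff_ne_zero.2 hle'))
  convert this using 1
  rw [← Set.image_inter Sum.inl_injective, ← Set.image_singleton]
  congr 1
  ext u
  constructor
  · rintro rfl
    exact ⟨he, he'⟩
  · rintro ⟨hu, hu'⟩
    by_contra huv
    exact hne (Subtype.ext (((Sym2.mem_and_mem_iff huv).1 ⟨hu, he⟩).trans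
      ((Sym2.mem_and_mem_iff huv).1 ⟨hu', he'⟩).symm))

/-- A leaf is reached through its neighbour `w`, which cannot also be a leaf, since a connected
graph on at least three vertices is not a single edge. -/
theorem singleton_inl_mem [Fintype V] (hG : G.Connected) (hcard : 3 ≤ Fintype.card V) (v : V) :
    {Sum.inl v} ∈ 𝒢 := by
  by_cases hv : (G.neighborSet v).ncard = 1
  swap
  · exact singleton_inl_mem_of_ncard hsd h𝒢 hodd hlen hkeep hv
  obtain ⟨w, hw⟩ := Set.ncard_eq_one.1 hv
  have hvw : G.Adj v w := by
    rw [← SimpleGraph.mem_neighborSet, hw]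
    rfl
  have hw1 : (G.neighborSet w).ncard ≠ 1 := by
    intro h
    obtain ⟨v', hv'⟩ := Set.ncard_eq_one.1 h
    have hwv : v ∈ G.neighborSet w := hvw.symm
    obtain rfl : v = v' := by simpa [hv'] using hwv
    have hall : ∀ u, u = v ∨ u = w := by
      intro u
      have := (G.reachable_iff_reflTransGen v u).1 (hG.preconnected v u)
      induction this with
      | refl => exact Or.inl rfl
      | tail _ hab ih =>
        rcases ih with rfl | rfl
        · right
          rw [← SimpleGraph.mem_neighborSet, hw] at hab
          exact hab
        · left
          rw [← SimpleGraph.mem_neighborSet, hv'] at hab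
          exact hab
    classical
    have : Fintype.card V ≤ ({v, w} : Finset V).card :=
      Finset.card_le_card fun u _ => by simpa using hall u
    have := this.trans Finset.card_le_two
    omega
  have hwm := singleton_inl_mem_of_ncard hsd h𝒢 hodd hlen hkeep hw1
  rcases Nat.eq_zero_or_pos (len ⟨s(v, w), hvw⟩) with h0 | h0
  -- If the leaf edge is the unique unsubdivided one, `v` is the only original vertex adjacent to
  -- `w`.
  · have := h𝒢.inter_mem (h𝒢.oddNbrs_mem hwm) (range_inl_mem hsd h𝒢 hodd)
    convert this using 1
    ext x
    rcases x with u | ⟨e, j⟩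
    · rw [Set.mem_singleton_iff, Set.mem_inter_iff, oddNbrs_singleton,
        SimpleGraph.mem_neighborSet, adj_iff hsd, Sum.inl.injEq]
      constructor
      · rintro rfl
        refine ⟨⟨⟨s(u, w), hvw⟩, 0, Nat.zero_le _, ?_⟩, u, rfl⟩
        rw [pos_zero, pos_last _ (by omega)]
        rcases Sym2.eq_iff.1 (hsd ⟨s(u, w), hvw⟩) with ⟨h1, h2⟩ | ⟨h1, h2⟩
        · rw [h1, h2]
          exact Or.inr ⟨rfl, rfl⟩
        · rw [h1, h2]
          exact Or.inl ⟨rfl, rfl⟩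
      · rintro ⟨⟨e, i, hi, h⟩, -⟩
        have key : ∀ a b, Sum.inl a = pos src dst len e i → Sum.inl b = pos src dst len e (i + 1) →
            len e = 0 ∧ s(a, b) = (e : Sym2 V) := by
          intro a b ha hb
          rcases pos_eq_inl.1 ha.symm with ⟨rfl, rfl⟩ | ⟨h1, -⟩
          · rcases pos_eq_inl.1 hb.symm with ⟨h1, -⟩ | ⟨h1, rfl⟩
            · omega
            · exact ⟨by omega, hsd e⟩
          · omega
        have hwu : s(w, u) = (e : Sym2 V) ∧ len e = 0 := by
          rcases h with ⟨h1, h2⟩ | ⟨h1, h2⟩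
          · exact (key w u h1 h2).symm
          · obtain ⟨h3, h4⟩ := key u w h1 h2
            exact ⟨by rw [Sym2.eq_swap, h4], h3⟩
        have he : e = ⟨s(v, w), hvw⟩ := hkeep hwu.2 h0
        have := hwu.1
        rw [he, Sym2.eq_swap] at this
        exact Sym2.congr_left.1 this
    · simp
  · have := h𝒢.inter_mem (ends_mem hsd h𝒢 hodd hlen ⟨s(v, w), hvw⟩ h0) (h𝒢.compl_mem hwm)
    convert this using 1
    ext x
    rcases x with u | ⟨e, j⟩
    · have := hvw.ne
      simp
      grind
    · simp

/-- Walk along the path from `src e`: each further vertex is the neighbour of the current one that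
is not the previous one. The first step needs a set that singles out `e` among the paths at `src e`.
-/
theorem singleton_pos_mem [Fintype V] (hG : G.Connected) (hcard : 3 ≤ Fintype.card V)
    (e : G.edgeSet) (i : ℕ) (hi : i ≤ len e) :
    {pos src dst len e i} ∈ 𝒢 ∧ {pos src dst len e (i + 1)} ∈ 𝒢 := by
  have hinl := singleton_inl_mem hsd h𝒢 hodd hlen hkeep hG hcard
  induction i with
  | zero =>
    rw [pos_zero]
    refine ⟨hinl _, ?_⟩
    rcases Nat.eq_zero_or_pos (len e) with h0 | h0
    · rw [pos_last e (by omega)]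
      exact hinl _
    · have key : ∃ q : G.edgeSet → ℕ → Prop, onPaths q ∈ 𝒢 ∧ q e 0 ∧
          ∀ e' j, q e' j → j = 0 ∨ len e' < j + 2 ∧ dst e' = src e → e' = e ∧ j = 0 := by
        rcases (Nat.succ_le_of_lt h0).eq_or_lt with h1 | h1
        · refine ⟨_, middle_mem hsd h𝒢 hodd, by simpa using h1, fun e' j hq h => ?_⟩
          have h2 : len e' = len e := by omega
          exact ⟨hlen (show 1 ≤ len e' by omega) h0 h2, by omega⟩
        · refine ⟨_, pair_mem hsd h𝒢 hodd hlen e (len e - 2) 0 (by omega), by simp,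
            fun e' j hq h => ⟨hq.1, ?_⟩⟩
          obtain rfl := hq.1
          exact h.resolve_right fun h' => src_ne_dst hsd e' h'.2.symm
      obtain ⟨q, hq, hq0, hq1⟩ := key
      have := h𝒢.inter_mem (h𝒢.oddNbrs_mem (hinl (src e))) hq
      convert this using 1
      ext x
      rw [Set.mem_singleton_iff, Set.mem_inter_iff, oddNbrs_singleton, SimpleGraph.mem_neighborSet,
        zero_add]
      constructor
      · rintro rfl
        refine ⟨(adj_iff hsd).2 ⟨e, 0, Nat.zero_le _, Or.inl ⟨(pos_zero e).symm, rfl⟩⟩, ?_⟩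
        rw [pos_succ e h0]
        exact hq0
      · rintro ⟨hadj, hx⟩
        rcases x with v | ⟨e', j⟩
        · exact hx.elim
        · have hmem : Sum.inl (src e) ∈ (subdivision G src dst len).neighborSet
            (Sum.inr ⟨e', j⟩) := hadj.symm
          rw [neighborSet_inr hsd, Set.mem_insert_iff, Set.mem_singleton_iff,
            @eq_comm _ (Sum.inl (src e)), @eq_comm _ (Sum.inl (src e)), pos_eq_inl,
            pos_eq_inl] at hmem
          obtain ⟨rfl, hj⟩ := hq1 e' j hx (by
            rcases hmem with (h | h) | h | h
            · exact Or.inl h.1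
            · exact Or.inr ⟨by omega, h.2⟩
            · omega
            · exact Or.inr ⟨by omega, h.2⟩)
          rw [eq_comm, pos_eq_inr]
          exact ⟨rfl, by omega⟩
  | succ i ih =>
    have hi' : i < len e := hi
    obtain ⟨h1, h2⟩ := ih hi'.le
    refine ⟨h2, ?_⟩
    have := h𝒢.inter_mem (h𝒢.oddNbrs_mem h2) (h𝒢.compl_mem h1)
    convert this using 1
    rw [oddNbrs_singleton, pos_succ e hi', neighborSet_inr hsd]
    have hne : pos src dst len e (i + 2) ≠ pos src dst len e i := fun h => by
      have := pos_inj hsd (by omega) (by omega) h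
      omega
    ext x
    simp only [Set.mem_singleton_iff, Set.mem_inter_iff, Set.mem_insert_iff, Set.mem_compl_iff]
    grind

omit h𝒢 hodd hlen hkeep in
theorem parityDiscrete [Fintype V] (hG : IsOddGraph G) {len : G.edgeSet → ℕ}
    (hlen : Set.InjOn len {e | 1 ≤ len e}) (hkeep : {e | len e = 0}.Subsingleton) :
    ParityDiscrete (subdivision G src dst len) := by
  obtain ⟨hconn, hcard, hodd⟩ := hG
  rintro 𝒢 h𝒢 (v | ⟨e, j⟩)
  · exact singleton_inl_mem hsd h𝒢 hodd hlen hkeep hconn hcard v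
  · rw [← pos_succ e j.2]
    exact (singleton_pos_mem hsd h𝒢 hodd hlen hkeep hconn hcard e j j.2.le).2

end Subdivision

theorem IsAsymSubdividedOddGraph.dla_eq_su {V : Type*} [Fintype V] [DecidableEq V]
    {H : SimpleGraph V} (h : IsAsymSubdividedOddGraph H) : dla H (fun _ => 1) = su (V → Fin 2) ∧
      Module.finrank ℝ (dla H fun _ => 1) = 4 ^ Fintype.card V - 1 := by
  obtain ⟨V₀, _, G, src, dst, len, hG, hsd, hkeep, hlen, ⟨f⟩⟩ := h
  exact ((Subdivision.parityDiscrete hsd hG hlen hkeep).of_iso f).dla_eq_su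
    (f.connected_iff.2 (Subdivision.connected hsd hG.1))

end

/-! ### Counting graphs -/

section Counting

variable {ι : Type*} [Fintype ι]

/-- A member of `𝒜` is determined by its edges outside `Q`, so refilling `Q` arbitrarily gives `2 ^
Q.card` graphs per member without collisions. -/
theorem ncard_mul_two_pow_le {𝒜 : Set (SimpleGraph ι)} {Q : Finset (Sym2 ι)}
    (hQ : ∀ e ∈ Q, ¬ e.IsDiag)
    (h : ∀ G ∈ 𝒜, ∀ H ∈ 𝒜, (∀ e, e ∉ Q → (e ∈ G.edgeSet ↔ e ∈ H.edgeSet)) → G = H) :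
    𝒜.ncard * 2 ^ Q.card ≤ Nat.card (SimpleGraph ι) := by
  classical
  let f : 𝒜 × Q.powerset → SimpleGraph ι := fun a =>
    SimpleGraph.fromEdgeSet ((a.1.1.edgeSet \ Q) ∪ (a.2.1 : Set (Sym2 ι)))
  have hf : ∀ a e, e ∈ (f a).edgeSet ↔ if e ∈ Q then e ∈ a.2.1 else e ∈ a.1.1.edgeSet := by
    intro a e
    have hR : a.2.1 ⊆ Q := Finset.mem_powerset.1 a.2.2
    have hdiag : e ∈ a.1.1.edgeSet → ¬ e.IsDiag := a.1.1.not_isDiag_of_mem_edgeSet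
    have h1 := @hR e
    have h2 := hQ e
    simp only [f, SimpleGraph.edgeSet_fromEdgeSet, Set.mem_sdiff, Set.mem_union, Finset.mem_coe]
    change _ ∧ ¬ e.IsDiag ↔ _
    split_ifs <;> tauto
  have hinj : Function.Injective f := by
    rintro ⟨⟨G, hG⟩, R, hR⟩ ⟨⟨H, hH⟩, R', hR'⟩ heq
    have hmem : ∀ e, (if e ∈ Q then e ∈ R else e ∈ G.edgeSet) ↔
        if e ∈ Q then e ∈ R' else e ∈ H.edgeSet := by
      intro e
      have h1 := hf ⟨⟨G, hG⟩, R, hR⟩ e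
      rw [heq, hf] at h1
      exact h1.symm
    have hGH : G = H := h G hG H hH fun e he => by simpa [he] using hmem e
    have hRR : R = R' := by
      ext e
      by_cases he : e ∈ Q
      · simpa [he] using hmem e
      · exact ⟨fun h => absurd (Finset.mem_powerset.1 hR h) he,
          fun h => absurd (Finset.mem_powerset.1 hR' h) he⟩
    subst hGH hRR
    rfl
  have := Nat.card_le_card_of_injective f hinj
  rwa [Nat.card_prod, Nat.card_coe_set_eq, Nat.card_eq_fintype_card, Fintype.card_coe,
    Finset.card_powerset] at this

theorem ncard_le_of_mul_two_pow_le {a q m : ℕ} (h : a * 2 ^ q ≤ m) :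
    (a : ℝ) ≤ m * (1 / 2) ^ q := by
  have h' : (a : ℝ) * 2 ^ q ≤ m := by exact_mod_cast h
  rw [one_div, inv_pow, ← div_eq_mul_inv, le_div_iff₀ (by positivity)]
  exact h'

theorem ncard_no_crossing_le (S : Finset ι) :
    {G : SimpleGraph ι | ∀ u ∈ S, ∀ v ∉ S, ¬ G.Adj u v}.ncard *
      2 ^ (S.card * (Fintype.card ι - S.card)) ≤ Nat.card (SimpleGraph ι) := by
  classical
  have hcard : ((S ×ˢ Sᶜ).image fun p => s(p.1, p.2)).card =
      S.card * (Fintype.card ι - S.card) := by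
    rw [Finset.card_image_of_injOn, Finset.card_product, Finset.card_compl]
    rintro ⟨a, b⟩ h1 ⟨c, d⟩ h2 h
    simp only [Finset.coe_product, Set.mem_prod, Finset.mem_coe, Finset.mem_compl] at h1 h2
    rcases Sym2.eq_iff.1 h with ⟨rfl, rfl⟩ | ⟨rfl, rfl⟩
    · rfl
    · exact absurd h1.1 h2.2
  rw [← hcard]
  apply ncard_mul_two_pow_le
  · intro e he
    obtain ⟨⟨a, b⟩, hab, rfl⟩ := Finset.mem_image.1 he
    rw [Finset.mem_product, Finset.mem_compl] at hab
    rw [Sym2.mk_isDiag_iff]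
    intro h
    exact hab.2 (h ▸ hab.1)
  · intro G hG H hH h
    have hno : ∀ G : SimpleGraph ι, (∀ u ∈ S, ∀ v ∉ S, ¬ G.Adj u v) →
        ∀ e ∈ (S ×ˢ Sᶜ).image (fun p => s(p.1, p.2)), e ∉ G.edgeSet := by
      intro G hG e he
      obtain ⟨⟨a, b⟩, hab, rfl⟩ := Finset.mem_image.1 he
      rw [Finset.mem_product, Finset.mem_compl] at hab
      exact hG a hab.1 b hab.2
    rw [← SimpleGraph.edgeSet_inj]
    ext e
    by_cases he : e ∈ (S ×ˢ Sᶜ).image fun p => s(p.1, p.2)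
    · exact iff_of_false (hno G hG e he) (hno H hH e he)
    · exact h e he

theorem exists_no_crossing [Nonempty ι] {G : SimpleGraph ι} (hG : ¬ G.Connected) :
    ∃ S : Finset ι, S.Nonempty ∧ 2 * S.card ≤ Fintype.card ι ∧
      ∀ u ∈ S, ∀ v ∉ S, ¬ G.Adj u v := by
  classical
  have : ∃ u v, ¬ G.Reachable u v := by
    by_contra! h
    exact hG ⟨h⟩
  obtain ⟨u, v, huv⟩ := this
  let S : Finset ι := Finset.univ.filter (G.Reachable u)
  have hS : ∀ a ∈ S, ∀ b ∉ S, ¬ G.Adj a b := by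
    intro a ha b hb hab
    simp only [S, Finset.mem_filter, Finset.mem_univ, true_and] at ha hb
    exact hb (ha.trans hab.reachable)
  rcases le_total (2 * S.card) (Fintype.card ι) with h | h
  · exact ⟨S, ⟨u, by simp [S]⟩, h, hS⟩
  · refine ⟨Sᶜ, ⟨v, by simp [S, huv]⟩, ?_, fun a ha b hb hab => ?_⟩
    · rw [Finset.card_compl]
      have := S.card_le_univ
      omega
    · exact hS b (by simpa using hb) a (by simpa using ha) hab.symm

/-- Union bound over the smaller sides `S` of empty cuts. Each cut has at least `S.card * (n / 2)`
pairs, and the binomial theorem sums over nonempty `S`. -/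
theorem ncard_not_connected_le [Nonempty ι] :
    ({G : SimpleGraph ι | ¬ G.Connected}.ncard : ℝ) ≤ Nat.card (SimpleGraph ι) *
      ((1 + (1 / 2) ^ (Fintype.card ι / 2)) ^ Fintype.card ι - 1) := by
  classical
  set n := Fintype.card ι with hn
  set x : ℝ := (1 / 2) ^ (n / 2) with hx
  let 𝒮 : Finset (Finset ι) :=
    Finset.univ.powerset.filter fun S => S.Nonempty ∧ 2 * S.card ≤ n
  have hsub : {G : SimpleGraph ι | ¬ G.Connected} ⊆
      ⋃ S ∈ 𝒮, {G : SimpleGraph ι | ∀ u ∈ S, ∀ v ∉ S, ¬ G.Adj u v} := by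
    intro G hG
    obtain ⟨S, h1, h2, h3⟩ := exists_no_crossing hG
    simp only [Set.mem_iUnion]
    exact ⟨S, Finset.mem_filter.2 ⟨by simp, h1, h2⟩, h3⟩
  have h1 : ({G : SimpleGraph ι | ¬ G.Connected}.ncard : ℝ) ≤
      ∑ S ∈ 𝒮, ({G : SimpleGraph ι | ∀ u ∈ S, ∀ v ∉ S, ¬ G.Adj u v}.ncard : ℝ) := by
    exact_mod_cast (Set.ncard_le_ncard hsub (Set.toFinite _)).trans
      (Finset.set_ncard_biUnion_le _ _)
  have h2 : ∀ S ∈ 𝒮, ({G : SimpleGraph ι | ∀ u ∈ S, ∀ v ∉ S, ¬ G.Adj u v}.ncard : ℝ) ≤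
      Nat.card (SimpleGraph ι) * x ^ S.card := by
    intro S hS
    refine (ncard_le_of_mul_two_pow_le (ncard_no_crossing_le S)).trans ?_
    have hS2 : 2 * S.card ≤ n := (Finset.mem_filter.1 hS).2.2
    gcongr
    rw [hx, ← pow_mul, mul_comm]
    exact pow_le_pow_of_le_one (by norm_num) (by norm_num)
      (Nat.mul_le_mul_right _ (by omega))
  have h3 : ∑ S ∈ 𝒮, x ^ S.card ≤ (1 + x) ^ n - 1 := by
    have h4 := Finset.sum_pow_mul_eq_add_pow x 1 (Finset.univ : Finset ι)
    rw [Finset.card_univ, ← hn, add_comm x] at h4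
    simp only [one_pow, mul_one] at h4
    rw [← h4, ← Finset.add_sum_erase _ _ (Finset.empty_mem_powerset _)]
    simp only [Finset.card_empty, pow_zero, add_sub_cancel_left]
    refine Finset.sum_le_sum_of_subset_of_nonneg ?_ fun _ _ _ => by positivity
    intro S hS
    have := (Finset.mem_filter.1 hS).2.1
    simp [this.ne_empty]
  calc ({G : SimpleGraph ι | ¬ G.Connected}.ncard : ℝ)
      ≤ ∑ S ∈ 𝒮, Nat.card (SimpleGraph ι) * x ^ S.card := h1.trans (Finset.sum_le_sum h2)
    _ = Nat.card (SimpleGraph ι) * ∑ S ∈ 𝒮, x ^ S.card := (Finset.mul_sum _ _ _).symm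
    _ ≤ _ := by gcongr

/-! ### Counting isomorphism classes -/

/-- A set of pairs that is disjoint from its image under a permutation and contains at least one
third of the pairs that are moved. -/
theorem exists_third_moved {α : Type*} [Fintype α] [DecidableEq α] (τ : Equiv.Perm α)
    (P : Finset α) (hP : ∀ a ∈ P, τ a ≠ a) :
    ∃ Q ⊆ P, (∀ a ∈ Q, τ a ∉ Q) ∧ P.card ≤ 3 * Q.card := by
  obtain ⟨Q, hQ, hmax⟩ := Finset.exists_max_image
    (P.powerset.filter fun Q => ∀ a ∈ Q, τ a ∉ Q) Finset.card ⟨∅, by simp⟩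
  rw [Finset.mem_filter, Finset.mem_powerset] at hQ
  refine ⟨Q, hQ.1, hQ.2, ?_⟩
  -- A point outside all three sets could be added to `Q`, against maximality.
  have hcover : P ⊆ Q ∪ Q.image τ ∪ Q.image τ.symm := by
    intro a ha
    by_contra hna
    simp only [Finset.mem_union, Finset.mem_image, not_or, not_exists, not_and] at hna
    obtain ⟨⟨h1, h2⟩, h3⟩ := hna
    have h4 : τ a ∉ Q := fun h => h3 _ h (by simp)
    have := hmax (insert a Q) (by
      rw [Finset.mem_filter, Finset.mem_powerset]
      refine ⟨Finset.insert_subset ha hQ.1, fun b hb => ?_⟩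
      rw [Finset.mem_insert, not_or]
      rcases Finset.mem_insert.1 hb with rfl | hb
      · exact ⟨hP b ha, h4⟩
      · exact ⟨h2 b hb, hQ.2 b hb⟩)
    rw [Finset.card_insert_of_notMem h1] at this
    omega
  have h1 := Finset.card_le_card hcover
  have h2 := Finset.card_union_le (Q ∪ Q.image τ) (Q.image τ.symm)
  have h3 := Finset.card_union_le Q (Q.image τ)
  have h4 := Finset.card_image_le (s := Q) (f := τ)
  have h5 := Finset.card_image_le (s := Q) (f := τ.symm)
  omega

variable [DecidableEq ι]

/-- If `a` is moved and `b` is neither `a` nor `σ a`, then the pair `a`, `b` is moved; each pair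
arises at most twice. -/
theorem card_moved_pairs (σ : Equiv.Perm ι) :
    (Finset.univ.filter fun i => σ i ≠ i).card * (Fintype.card ι - 2) ≤
      2 * (Finset.univ.filter fun e : Sym2 ι => ¬ e.IsDiag ∧ Sym2.map σ e ≠ e).card := by
  have h1 : ∀ a, Fintype.card ι - 2 ≤ ((Finset.univ.erase a).erase (σ a)).card := by
    intro a
    have h2 := Finset.pred_card_le_card_erase (s := Finset.univ.erase a) (a := σ a)
    have h3 := Finset.pred_card_le_card_erase (s := Finset.univ) (a := a)
    rw [Finset.card_univ] at h3
    omega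
  have h2 : (Finset.univ.filter fun i => σ i ≠ i).card * (Fintype.card ι - 2) ≤
      ((Finset.univ.filter fun i => σ i ≠ i).sigma fun a =>
        (Finset.univ.erase a).erase (σ a)).card := by
    rw [Finset.card_sigma, ← smul_eq_mul]
    exact Finset.card_nsmul_le_sum _ _ _ fun a _ => h1 a
  refine h2.trans ?_
  refine Finset.card_le_mul_card_image_of_maps_to (f := fun p => s(p.1, p.2)) ?_ 2 ?_
  · rintro ⟨a, b⟩ hab
    simp only [Finset.mem_sigma, Finset.mem_filter, Finset.mem_univ, true_and,
      Finset.mem_erase, and_true] at hab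
    simp only [Finset.mem_filter, Finset.mem_univ, true_and, Sym2.mk_isDiag_iff, Sym2.map_mk]
    refine ⟨Ne.symm hab.2.2, fun h => ?_⟩
    rcases Sym2.eq_iff.1 h with h | h
    · exact hab.1 h.1
    · exact hab.2.1 h.1.symm
  · intro e _
    induction e with
    | _ c d =>
      refine (Finset.card_le_card (t := {⟨c, d⟩, ⟨d, c⟩}) ?_).trans Finset.card_le_two
      rintro ⟨a, b⟩ hab
      rcases Sym2.eq_iff.1 (Finset.mem_filter.1 hab).2 with ⟨rfl, rfl⟩ | ⟨rfl, rfl⟩ <;> simp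

/-- In an invariant graph the edges in `Q` are dictated by their images, which lie outside `Q`. The
6 is 3 from choosing `Q` times 2 from double counting pairs. -/
theorem ncard_invariant_le (σ : Equiv.Perm ι) :
    ({G : SimpleGraph ι | ∀ u v, G.Adj (σ u) (σ v) ↔ G.Adj u v}.ncard : ℝ) ≤
      Nat.card (SimpleGraph ι) *
        ((1 / 2) ^ ((Fintype.card ι - 2) / 6)) ^ (Finset.univ.filter fun i => σ i ≠ i).card := by
  obtain ⟨Q, hQP, hQ, hcard⟩ := exists_third_moved (Equiv.ofBijective (Sym2.map σ)
    ⟨Sym2.map.injective σ.injective, Finite.injective_iff_surjective.1 (Sym2.map.injective σ.injective)⟩)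
    (Finset.univ.filter fun e : Sym2 ι => ¬ e.IsDiag ∧ Sym2.map σ e ≠ e)
    (fun e he => (Finset.mem_filter.1 he).2.2)
  have hle : {G : SimpleGraph ι | ∀ u v, G.Adj (σ u) (σ v) ↔ G.Adj u v}.ncard * 2 ^ Q.card ≤
      Nat.card (SimpleGraph ι) := by
    apply ncard_mul_two_pow_le
    · exact fun e he => (Finset.mem_filter.1 (hQP he)).2.1
    · intro G hG H hH h
      have hinv : ∀ G : SimpleGraph ι, (∀ u v, G.Adj (σ u) (σ v) ↔ G.Adj u v) →
          ∀ e, Sym2.map σ e ∈ G.edgeSet ↔ e ∈ G.edgeSet := by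
        intro G hG e
        induction e with
        | _ a b => exact hG a b
      rw [← SimpleGraph.edgeSet_inj]
      ext e
      by_cases he : e ∈ Q
      · rw [← hinv G hG, ← hinv H hH]
        exact h _ (hQ e he)
      · exact h e he
  refine (ncard_le_of_mul_two_pow_le hle).trans ?_
  gcongr
  rw [← pow_mul]
  refine pow_le_pow_of_le_one (by norm_num) (by norm_num) ?_
  have h1 := card_moved_pairs σ
  set k := (Finset.univ.filter fun i => σ i ≠ i).card
  have h2 : k * (6 * ((Fintype.card ι - 2) / 6)) ≤ k * (Fintype.card ι - 2) :=
    Nat.mul_le_mul_left _ (Nat.mul_div_le _ _)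
  have h3 : k * (6 * ((Fintype.card ι - 2) / 6)) = 6 * ((Fintype.card ι - 2) / 6 * k) := by ring
  omega

/-- Enlarging the sum from permutations to all self-maps makes it factor over the points. -/
theorem sum_perm_pow_le {y : ℝ} (hy : 0 ≤ y) :
    ∑ σ : Equiv.Perm ι, y ^ (Finset.univ.filter fun i => σ i ≠ i).card ≤
      (1 + Fintype.card ι * y) ^ Fintype.card ι := by
  have h1 : ∀ f : ι → ι, y ^ (Finset.univ.filter fun i => f i ≠ i).card =
      ∏ i, if f i = i then 1 else y := by
    intro f
    rw [Finset.prod_ite, Finset.prod_const_one, one_mul, Finset.prod_const]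
  calc ∑ σ : Equiv.Perm ι, y ^ (Finset.univ.filter fun i => σ i ≠ i).card
      = ∑ f ∈ Finset.univ.image (fun σ : Equiv.Perm ι => (σ : ι → ι)),
          ∏ i, (if f i = i then 1 else y) := by
        rw [Finset.sum_image fun _ _ _ _ h => DFunLike.coe_injective h]
        exact Finset.sum_congr rfl fun σ _ => h1 σ
    _ ≤ ∑ f : ι → ι, ∏ i, (if f i = i then 1 else y) := by
        refine Finset.sum_le_sum_of_subset_of_nonneg (Finset.subset_univ _) fun f _ _ => ?_
        exact Finset.prod_nonneg fun i _ => by split_ifs <;> positivity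
    _ = ∏ i : ι, ∑ j : ι, (if j = i then 1 else y) :=
        (Fintype.prod_sum fun i j => if j = i then (1 : ℝ) else y).symm
    _ ≤ ∏ _i : ι, (1 + Fintype.card ι * y) := by
        refine Finset.prod_le_prod (fun i _ => Finset.sum_nonneg fun j _ => by
          split_ifs <;> positivity) fun i _ => ?_
        calc ∑ j : ι, (if j = i then 1 else y) ≤ ∑ j : ι, ((if j = i then 1 else 0) + y) := by
              refine Finset.sum_le_sum fun j _ => ?_
              split_ifs <;> linarith
          _ = _ := by simp [Finset.sum_add_distrib]
    _ = _ := by simp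

end Counting

/-- Permutations of the vertices act on graphs. -/
abbrev permAction (n : ℕ) : MulAction (Equiv.Perm (Fin n)) (SimpleGraph (Fin n)) where
  smul σ G := G.comap σ.symm
  one_smul G := by ext; rfl
  mul_smul σ τ G := by ext; rfl

/-- Burnside's lemma, with the fixed-point bound for each permutation. -/
theorem card_graphClass_mul_factorial_le (n : ℕ) :
    (Nat.card (GraphClass n) : ℝ) * n.factorial ≤ Nat.card (SimpleGraph (Fin n)) *
      (1 + n * (1 / 2) ^ ((n - 2) / 6)) ^ n := by
  classical
  let := permAction n
  have hset : MulAction.orbitRel (Equiv.Perm (Fin n)) (SimpleGraph (Fin n)) = isoSetoid n := by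
    ext G H
    constructor
    · rintro ⟨σ, rfl⟩
      exact ⟨⟨σ.symm, Iff.rfl⟩⟩
    · rintro ⟨f⟩
      refine ⟨f.toEquiv.symm, ?_⟩
      ext u v
      exact f.map_adj_iff
  have hB := MulAction.sum_card_fixedBy_eq_card_orbits_mul_card_group
    (Equiv.Perm (Fin n)) (SimpleGraph (Fin n))
  rw [Fintype.card_perm, Fintype.card_fin, ← Nat.card_eq_fintype_card, hset] at hB
  have hfix : ∀ σ : Equiv.Perm (Fin n),
      (Fintype.card (MulAction.fixedBy (SimpleGraph (Fin n)) σ) : ℝ) ≤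
        Nat.card (SimpleGraph (Fin n)) *
          ((1 / 2) ^ ((n - 2) / 6)) ^ (Finset.univ.filter fun i => σ i ≠ i).card := by
    intro σ
    have := ncard_invariant_le σ
    rw [Fintype.card_fin] at this
    refine le_trans ?_ this
    rw [← Nat.card_eq_fintype_card, Nat.card_coe_set_eq]
    norm_cast
    refine Set.ncard_le_ncard (fun G hG u v => ?_) (Set.toFinite _)
    have hG' : G.comap σ.symm = G := hG
    conv_lhs => rw [← hG']
    simp
  calc (Nat.card (GraphClass n) : ℝ) * n.factorial
      = ∑ σ : Equiv.Perm (Fin n),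
        (Fintype.card (MulAction.fixedBy (SimpleGraph (Fin n)) σ) : ℝ) := by exact_mod_cast hB.symm
    _ ≤ _ := Finset.sum_le_sum fun σ _ => hfix σ
    _ = _ := (Finset.mul_sum _ _ _).symm
    _ ≤ _ := by
      have := sum_perm_pow_le (ι := Fin n) (y := (1 / 2) ^ ((n - 2) / 6)) (by positivity)
      rw [Fintype.card_fin] at this
      gcongr

theorem ncard_le_factorial_mul_ncard_image (n : ℕ) (𝒜 : Set (SimpleGraph (Fin n))) :
    𝒜.ncard ≤ n.factorial * (Quotient.mk (isoSetoid n) '' 𝒜).ncard := by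
  classical
  rw [Set.ncard_eq_toFinset_card', Set.ncard_eq_toFinset_card', Set.toFinset_image]
  refine Finset.card_le_mul_card_image _ _ fun q _ => ?_
  induction q using Quotient.inductionOn with
  | _ H =>
    calc _ ≤ (Finset.univ.image fun σ : Equiv.Perm (Fin n) => H.comap σ).card := by
          refine Finset.card_le_card fun G hG => ?_
          obtain ⟨f⟩ := Quotient.exact (Finset.mem_filter.1 hG).2
          refine Finset.mem_image.2 ⟨f.toEquiv, Finset.mem_univ _, ?_⟩
          ext u v
          exact f.map_adj_iff
      _ ≤ n.factorial := by
          refine Finset.card_image_le.trans ?_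
          rw [Finset.card_univ, Fintype.card_perm, Fintype.card_fin]

/-- Each class has at most `n!` labelled members, so the good classes number at least `𝒜.ncard /
n!`; the total is at most `(1 + ε)` times the number of graphs over `n!`, and `(1 - δ - ε) (1 + ε) ≤
1 - δ`. -/
theorem class_fraction_le {n : ℕ} {𝒜 : Set (SimpleGraph (Fin n))} {δ ε : ℝ} (hδ : 0 ≤ δ)
    (hε : 0 ≤ ε) (h𝒜 : (1 - δ) * Nat.card (SimpleGraph (Fin n)) ≤ 𝒜.ncard)
    (hn : (1 + n * (1 / 2) ^ ((n - 2) / 6)) ^ n ≤ 1 + ε) :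
    (1 - (δ + ε)) * Nat.card (GraphClass n) ≤ (Quotient.mk (isoSetoid n) '' 𝒜).ncard := by
  have h1 := card_graphClass_mul_factorial_le n
  have h2 : (𝒜.ncard : ℝ) ≤ n.factorial * (Quotient.mk (isoSetoid n) '' 𝒜).ncard := by
    exact_mod_cast ncard_le_factorial_mul_ncard_image n 𝒜
  set M : ℝ := ((Nat.card (SimpleGraph (Fin n)) : ℕ) : ℝ) with hM
  set C : ℝ := ((Nat.card (GraphClass n) : ℕ) : ℝ) with hC
  set I : ℝ := (((Quotient.mk (isoSetoid n) '' 𝒜).ncard : ℕ) : ℝ) with hI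
  have hF : (0 : ℝ) < n.factorial := by exact_mod_cast n.factorial_pos
  have hM0 : 0 ≤ M := by positivity
  have hI0 : 0 ≤ I := by positivity
  rcases le_total (1 - (δ + ε)) 0 with h0 | h0
  · exact (mul_nonpos_of_nonpos_of_nonneg h0 (by positivity)).trans hI0
  have h3 : C * n.factorial ≤ M * (1 + ε) := h1.trans (by gcongr)
  have h4 : (1 - (δ + ε)) * C * n.factorial ≤ I * n.factorial := by
    calc (1 - (δ + ε)) * C * n.factorial = (1 - (δ + ε)) * (C * n.factorial) := by ring
      _ ≤ (1 - (δ + ε)) * (M * (1 + ε)) := by gcongr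
      _ = (1 - δ) * M - (δ * ε + ε * ε) * M := by ring
      _ ≤ (1 - δ) * M := by
        have : 0 ≤ (δ * ε + ε * ε) * M := by positivity
        linarith
      _ ≤ I * n.factorial := by linarith
  exact le_of_mul_le_mul_right h4 hF

/-! ### Krylov sequences of alternating matrices over the field with two elements -/

section Krylov

open Matrix

variable {ι : Type*} [Fintype ι] [DecidableEq ι]

/-- The vectors `A ^ j * 1`. -/
def krylov (A : Matrix ι ι (ZMod 2)) : ℕ → ι → ZMod 2
  | 0 => 1
  | j + 1 => A *ᵥ krylov A j

/-- The sequence `f, 1, A * 1, A ^ 2 * 1, …`. -/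
def testSeq (f : ι → ZMod 2) (A : Matrix ι ι (ZMod 2)) : ℕ → ι → ZMod 2
  | 0 => f
  | j + 1 => krylov A j

/-- The vectors `f, 1, A * 1, …, A ^ j * 1` are linearly independent. -/
def KrylovIndep (f : ι → ZMod 2) (A : Matrix ι ι (ZMod 2)) (j : ℕ) : Prop :=
  LinearIndependent (ZMod 2) fun i : Fin (j + 2) => testSeq f A i

variable (ι) in
open Classical in
/-- The symmetric matrices with zero diagonal over the field with two elements. -/
def altMatrices : Finset (Matrix ι ι (ZMod 2)) :=
  Finset.univ.filter fun A => A.IsSymm ∧ ∀ i, A i i = 0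

theorem mem_altMatrices {A : Matrix ι ι (ZMod 2)} :
    A ∈ altMatrices ι ↔ A.IsSymm ∧ ∀ i, A i i = 0 := by simp [altMatrices]

omit [DecidableEq ι] in
theorem exists_dotProduct_eq {m : ℕ} {v : Fin m → ι → ZMod 2} (hv : LinearIndependent (ZMod 2) v)
    (c : Fin m → ZMod 2) : ∃ a, ∀ i, v i ⬝ᵥ a = c i := by
  have hrank : (Matrix.of v).rank = Fintype.card (Fin m) := LinearIndependent.rank_matrix hv
  have hrange : LinearMap.range (Matrix.of v).mulVecLin = ⊤ := by
    apply Submodule.eq_top_of_finrank_eq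
    rw [← Matrix.rank, hrank, Module.finrank_fintype_fun_eq_card]
  obtain ⟨a, ha⟩ := LinearMap.range_eq_top.1 hrange c
  exact ⟨a, fun i => congrFun ha i⟩

open Classical in
/-- A vector with prescribed products with the vectors of a family, if there is one. -/
def dualVec {m : ℕ} (v : Fin m → ι → ZMod 2) (c : Fin m → ZMod 2) : ι → ZMod 2 :=
  if h : ∃ a, ∀ i, v i ⬝ᵥ a = c i then h.choose else 0

theorem dotProduct_dualVec {m : ℕ} {v : Fin m → ι → ZMod 2} (hv : LinearIndependent (ZMod 2) v)
    (c : Fin m → ZMod 2) (i : Fin m) : v i ⬝ᵥ dualVec v c = c i := by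
  have h := exists_dotProduct_eq hv c
  rw [dualVec, dif_pos h]
  exact h.choose_spec i

/-- The alternating matrix `a yᵀ + y aᵀ`. -/
def rankTwo (a y : ι → ZMod 2) : Matrix ι ι (ZMod 2) := vecMulVec a y + vecMulVec y a

theorem rankTwo_mem (a y : ι → ZMod 2) : rankTwo a y ∈ altMatrices ι := by
  rw [mem_altMatrices]
  refine ⟨?_, fun i => ?_⟩
  · ext i j
    simp [rankTwo, vecMulVec_apply]
    ring
  · simp only [rankTwo, Matrix.add_apply, vecMulVec_apply]
    rw [mul_comm (y i)]
    exact CharTwo.add_self_eq_zero _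

theorem add_mem_altMatrices {A B : Matrix ι ι (ZMod 2)} (hA : A ∈ altMatrices ι)
    (hB : B ∈ altMatrices ι) : A + B ∈ altMatrices ι := by
  rw [mem_altMatrices] at *
  exact ⟨hA.1.add hB.1, fun i => by simp [hA.2, hB.2]⟩

omit [DecidableEq ι] in
theorem rankTwo_mulVec (a y z : ι → ZMod 2) :
    rankTwo a y *ᵥ z = (z ⬝ᵥ y) • a + (z ⬝ᵥ a) • y := by
  rw [rankTwo, add_mulVec, vecMulVec_mulVec, vecMulVec_mulVec, dotProduct_comm y, dotProduct_comm a]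
  simp

omit [DecidableEq ι] in
theorem krylov_add {A B : Matrix ι ι (ZMod 2)} {j : ℕ} (h : ∀ i < j, B *ᵥ krylov A i = 0) :
    ∀ i ≤ j, krylov (A + B) i = krylov A i := by
  intro i
  induction i with
  | zero => intro _; rfl
  | succ i ih =>
    intro hi
    rw [krylov, krylov, ih (by omega), add_mulVec, h i (by omega), add_zero]

/-- The vector along which the matrix `A` is perturbed. -/
def pivot (f : ι → ZMod 2) (A : Matrix ι ι (ZMod 2)) (j : ℕ) : ι → ZMod 2 :=
  dualVec (fun i : Fin (j + 2) => testSeq f A i) (Pi.single (Fin.last _) 1)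

/-- A perturbation of `A` that does not change the Krylov vectors up to the `j`-th, and adds `y` to
the next one. -/
def perturb (f : ι → ZMod 2) (j : ℕ) (y : ι → ZMod 2) (A : Matrix ι ι (ZMod 2)) :
    Matrix ι ι (ZMod 2) := A + rankTwo (pivot f A j) y

/-! ### Perturbing one Krylov vector, and the resulting counts -/

variable {f : ι → ZMod 2} {A : Matrix ι ι (ZMod 2)} {j : ℕ} {y : ι → ZMod 2}

theorem krylov_dotProduct_pivot (h : KrylovIndep f A j) {i : ℕ} (hi : i ≤ j) :
    krylov A i ⬝ᵥ pivot f A j = if i = j then 1 else 0 := by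
  have := dotProduct_dualVec h (Pi.single (Fin.last _) 1) ⟨i + 1, by omega⟩
  change krylov A i ⬝ᵥ pivot f A j = _ at this
  rw [this, Pi.single_apply]
  simp [Fin.ext_iff]

/-- The perturbation sends `z` to `(z ⬝ y) a + (z ⬝ a) y` with `a` the pivot. All vectors up to the
`j`-th are orthogonal to `y`, and only the `j`-th pairs with `a` to 1. -/
theorem krylov_perturb (h : KrylovIndep f A j) (hy : ∀ i ≤ j, krylov A i ⬝ᵥ y = 0) :
    (∀ i ≤ j, krylov (perturb f j y A) i = krylov A i) ∧
      krylov (perturb f j y A) (j + 1) = krylov A (j + 1) + y := by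
  have h1 : ∀ i ≤ j, krylov (perturb f j y A) i = krylov A i := by
    refine krylov_add fun i hi => ?_
    rw [rankTwo_mulVec, hy i hi.le, krylov_dotProduct_pivot h hi.le, if_neg hi.ne]
    simp
  refine ⟨h1, ?_⟩
  rw [krylov, h1 j le_rfl, perturb, add_mulVec, rankTwo_mulVec, hy j le_rfl,
    krylov_dotProduct_pivot h le_rfl, if_pos rfl, krylov]
  simp

theorem testSeq_perturb (h : KrylovIndep f A j) (hy : ∀ i ≤ j, krylov A i ⬝ᵥ y = 0) :
    (fun i : Fin (j + 2) => testSeq f (perturb f j y A) i) =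
      fun i : Fin (j + 2) => testSeq f A i := by
  funext ⟨i, hi⟩
  cases i with
  | zero => rfl
  | succ i => exact (krylov_perturb h hy).1 i (by omega)

theorem krylovIndep_perturb (h : KrylovIndep f A j) (hy : ∀ i ≤ j, krylov A i ⬝ᵥ y = 0) :
    KrylovIndep f (perturb f j y A) j := by
  rw [KrylovIndep, testSeq_perturb h hy]
  exact h

theorem pivot_perturb (h : KrylovIndep f A j) (hy : ∀ i ≤ j, krylov A i ⬝ᵥ y = 0) :
    pivot f (perturb f j y A) j = pivot f A j := by
  rw [pivot, testSeq_perturb h hy, pivot]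

theorem perturb_perturb (h : KrylovIndep f A j) (hy : ∀ i ≤ j, krylov A i ⬝ᵥ y = 0) :
    perturb f j y (perturb f j y A) = A := by
  rw [perturb, pivot_perturb h hy, perturb, add_assoc]
  ext i k
  simp [CharTwo.add_self_eq_zero]

omit [DecidableEq ι] in
theorem KrylovIndep.of_succ (h : KrylovIndep f A (j + 1)) : KrylovIndep f A j :=
  (linearIndependent_finSucc'.1 h).1

omit [DecidableEq ι] in
theorem mem_span_of_not_krylovIndep (h : KrylovIndep f A j) (h' : ¬ KrylovIndep f A (j + 1)) :
    krylov A (j + 1) ∈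
      Submodule.span (ZMod 2) (Set.range fun i : Fin (j + 2) => testSeq f A i) := by
  by_contra hn
  exact h' (linearIndependent_finSucc'.2 ⟨h, hn⟩)

variable (f) in
open Classical in
/-- The alternating matrices with independent first Krylov vectors, all of which are orthogonal
to `f`. -/
def orthogonalMatrices (k : ℕ) : Finset (Matrix ι ι (ZMod 2)) :=
  (altMatrices ι).filter fun A => KrylovIndep f A k ∧ ∀ i ≤ k, f ⬝ᵥ krylov A i = 0

variable (f) in
open Classical in
/-- The alternating matrices whose Krylov vectors become dependent in a given step. -/
def degenerateMatrices (j : ℕ) : Finset (Matrix ι ι (ZMod 2)) :=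
  (altMatrices ι).filter fun A => KrylovIndep f A j ∧ ¬ KrylovIndep f A (j + 1)

/-- Choose `y` orthogonal to the Krylov vectors with `f ⬝ y = 1`. The perturbation is an involution
preserving the first `k` conditions and flipping the next, so the smaller set and its image are
disjoint in the larger. -/
theorem two_mul_card_orthogonalMatrices_succ_le (k : ℕ) :
    2 * (orthogonalMatrices f (k + 1)).card ≤ (orthogonalMatrices f k).card := by
  classical
  let b : Matrix ι ι (ZMod 2) → ι → ZMod 2 := fun A =>
    dualVec (fun i : Fin (k + 2) => testSeq f A i) (Pi.single 0 1)
  have hb : ∀ A, KrylovIndep f A k → (∀ i ≤ k, krylov A i ⬝ᵥ b A = 0) ∧ f ⬝ᵥ b A = 1 := by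
    intro A hA
    refine ⟨fun i hi => ?_, ?_⟩
    · have := dotProduct_dualVec hA (Pi.single 0 1) ⟨i + 1, by omega⟩
      change krylov A i ⬝ᵥ b A = _ at this
      rw [this, Pi.single_apply]
      simp [Fin.ext_iff]
    · have := dotProduct_dualVec hA (Pi.single 0 1) 0
      change f ⬝ᵥ b A = _ at this
      simp [this]
  let φ : Matrix ι ι (ZMod 2) → Matrix ι ι (ZMod 2) := fun A => perturb f k (b A) A
  have hind : ∀ A ∈ orthogonalMatrices f (k + 1), KrylovIndep f A k := fun A hA =>
    (Finset.mem_filter.1 hA).2.1.of_succ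
  have hφφ : ∀ A, KrylovIndep f A k → φ (φ A) = A := by
    intro A hA
    have : b (φ A) = b A := by
      simp only [b, φ]
      rw [testSeq_perturb hA (hb A hA).1]
    change perturb f k (b (φ A)) (φ A) = A
    rw [this]
    exact perturb_perturb hA (hb A hA).1
  have hsub : orthogonalMatrices f (k + 1) ⊆ orthogonalMatrices f k := by
    intro A hA
    obtain ⟨h1, h2, h3⟩ := Finset.mem_filter.1 hA
    exact Finset.mem_filter.2 ⟨h1, h2.of_succ, fun i hi => h3 i (by omega)⟩
  have himg : (orthogonalMatrices f (k + 1)).image φ ⊆ orthogonalMatrices f k := by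
    intro B hB
    obtain ⟨A, hA, rfl⟩ := Finset.mem_image.1 hB
    have hk := hind A hA
    obtain ⟨h1, h2, h3⟩ := Finset.mem_filter.1 hA
    refine Finset.mem_filter.2 ⟨add_mem_altMatrices h1 (rankTwo_mem _ _),
      krylovIndep_perturb hk (hb A hk).1, fun i hi => ?_⟩
    rw [(krylov_perturb hk (hb A hk).1).1 i hi]
    exact h3 i (by omega)
  have hdisj : Disjoint (orthogonalMatrices f (k + 1)) ((orthogonalMatrices f (k + 1)).image φ) := by
    rw [Finset.disjoint_left]
    intro B hB hB'
    obtain ⟨A, hA, rfl⟩ := Finset.mem_image.1 hB'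
    have hk := hind A hA
    have h1 := (Finset.mem_filter.1 hA).2.2 (k + 1) le_rfl
    have h2 := (Finset.mem_filter.1 hB).2.2 (k + 1) le_rfl
    rw [(krylov_perturb hk (hb A hk).1).2, dotProduct_add, h1, (hb A hk).2] at h2
    simp at h2
  have hcard := Finset.card_le_card (Finset.union_subset hsub himg)
  rw [Finset.card_union_of_disjoint hdisj, Finset.card_image_of_injOn] at hcard
  · omega
  · intro A hA B hB h
    rw [← hφφ A (hind A hA), ← hφφ B (hind B hB), h]

theorem card_orthogonalMatrices_mul_le (k : ℕ) :
    (orthogonalMatrices f k).card * 2 ^ k ≤ (altMatrices ι).card := by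
  classical
  induction k with
  | zero =>
    rw [pow_zero, mul_one]
    exact Finset.card_filter_le _ _
  | succ k ih =>
    refine le_trans ?_ ih
    rw [pow_succ, mul_comm (2 ^ k), ← mul_assoc]
    refine Nat.mul_le_mul_right _ ?_
    rw [mul_comm]
    exact two_mul_card_orthogonalMatrices_succ_le k

open Classical in
theorem two_pow_le_card_orthogonal {m : ℕ} (v : Fin m → ι → ZMod 2) :
    2 ^ Fintype.card ι ≤
      2 ^ m * (Finset.univ.filter fun y : ι → ZMod 2 => ∀ i, v i ⬝ᵥ y = 0).card := by
  let φ := (Matrix.of v).mulVecLin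
  have h1 := Submodule.card_eq_card_quotient_mul_card (LinearMap.ker φ)
  rw [Nat.card_congr φ.quotKerEquivRange.toEquiv] at h1
  have h2 : Nat.card (LinearMap.range φ) ≤ 2 ^ m := by
    have := Nat.card_le_card_of_injective _ (LinearMap.range φ).injective_subtype
    simpa using this
  have h3 : Nat.card (LinearMap.ker φ) =
      (Finset.univ.filter fun y : ι → ZMod 2 => ∀ i, v i ⬝ᵥ y = 0).card := by
    rw [← Set.ncard_coe_finset, ← Nat.card_coe_set_eq]
    refine Nat.card_congr (Equiv.setCongr ?_)
    ext y
    simp [φ, LinearMap.mem_ker, funext_iff, Matrix.mulVec]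
  have h4 : Nat.card (ι → ZMod 2) = 2 ^ Fintype.card ι := by simp
  rw [← h4, h1, ← h3, mul_comm]
  exact Nat.mul_le_mul_right _ h2

/-- Count pairs `(A, y)` with `y` orthogonal to the first `j + 1` Krylov vectors, via the perturbed
matrix `B`. There are at least `2 ^ (n - j - 1)` choices of `y` per `A`, while each `B` has at most
`2 ^ (j + 2)` preimages. -/
theorem card_degenerateMatrices_mul_le (j : ℕ) :
    (degenerateMatrices f j).card * 2 ^ Fintype.card ι ≤ 2 ^ (2 * j + 3) * (altMatrices ι).card := by
  classical
  let O : Matrix ι ι (ZMod 2) → Finset (ι → ZMod 2) := fun A =>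
    Finset.univ.filter fun y => ∀ i : Fin (j + 1), krylov A i ⬝ᵥ y = 0
  have hO : ∀ A, ∀ y ∈ O A, ∀ i ≤ j, krylov A i ⬝ᵥ y = 0 := fun A y hy i hi =>
    (Finset.mem_filter.1 hy).2 ⟨i, by omega⟩
  have h1 : (degenerateMatrices f j).card * 2 ^ Fintype.card ι ≤
      2 ^ (j + 1) * ((degenerateMatrices f j).sigma O).card := by
    rw [Finset.card_sigma, Finset.mul_sum, ← smul_eq_mul]
    exact Finset.card_nsmul_le_sum _ _ _ fun A _ => two_pow_le_card_orthogonal _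
  have h2 : ((degenerateMatrices f j).sigma O).card ≤ 2 ^ (j + 2) * (altMatrices ι).card := by
    refine Finset.card_le_mul_card_image_of_maps_to (f := fun p => perturb f j p.2 p.1) ?_ _ ?_
    · rintro ⟨A, y⟩ hp
      exact add_mem_altMatrices (Finset.mem_filter.1 (Finset.mem_sigma.1 hp).1).1 (rankTwo_mem _ _)
    · intro B _
      -- Degeneracy puts the old vector in the span of the test vectors shared by `A` and `B`, so
      -- `y` is the new vector of `B` plus an element of that span; then `A` is recovered by
      -- perturbing back.
      let ψ : (Fin (j + 2) → ZMod 2) → Σ _ : Matrix ι ι (ZMod 2), ι → ZMod 2 := fun c =>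
        let y := krylov B (j + 1) + ∑ i, c i • testSeq f B i
        ⟨perturb f j y B, y⟩
      have hsub : (((degenerateMatrices f j).sigma O).filter fun p => perturb f j p.2 p.1 = B) ⊆
          Finset.univ.image ψ := by
        rintro ⟨A, y⟩ hp
        rw [Finset.mem_filter, Finset.mem_sigma] at hp
        obtain ⟨⟨hA, hy⟩, rfl⟩ := hp
        obtain ⟨-, h1, h2⟩ := Finset.mem_filter.1 hA
        have hy' := hO A y hy
        obtain ⟨c, hc⟩ := (Submodule.mem_span_range_iff_exists_fun _).1
          (mem_span_of_not_krylovIndep h1 h2)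
        refine Finset.mem_image.2 ⟨c, Finset.mem_univ _, ?_⟩
        have hyc : krylov (perturb f j y A) (j + 1) +
            ∑ i : Fin (j + 2), c i • testSeq f (perturb f j y A) i = y := by
          have h3 : ∀ i : Fin (j + 2), testSeq f (perturb f j y A) i = testSeq f A i :=
            congrFun (testSeq_perturb h1 hy')
          simp only [(krylov_perturb h1 hy').2, ← hc, h3]
          rw [add_right_comm]
          ext i
          simp [CharTwo.add_self_eq_zero]
        simp only [ψ]
        rw [hyc, perturb_perturb h1 hy']
      refine (Finset.card_le_card hsub).trans (Finset.card_image_le.trans ?_)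
      simp
  calc _ ≤ _ := h1
    _ ≤ 2 ^ (j + 1) * (2 ^ (j + 2) * (altMatrices ι).card) := Nat.mul_le_mul_left _ h2
    _ = _ := by ring

open Classical in
-- Either the vectors stay independent through step `k`, and orthogonality costs `2 ^ (-k)`, or
-- dependence first occurs at some earlier step; the latter bounds form a geometric series.
theorem card_forall_orthogonal_le (hf : ∀ A, KrylovIndep f A 0) (k : ℕ) :
    (((altMatrices ι).filter fun A => ∀ i, f ⬝ᵥ krylov A i = 0).card : ℝ) ≤
      (altMatrices ι).card * ((1 / 2) ^ k + 8 * 4 ^ k / 2 ^ Fintype.card ι) := by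
  have hsub : ((altMatrices ι).filter fun A => ∀ i, f ⬝ᵥ krylov A i = 0) ⊆
      orthogonalMatrices f k ∪ (Finset.range k).biUnion (degenerateMatrices f) := by
    intro A hA
    obtain ⟨h1, h2⟩ := Finset.mem_filter.1 hA
    have key : KrylovIndep f A k ∨ ∃ j < k, KrylovIndep f A j ∧ ¬ KrylovIndep f A (j + 1) := by
      induction k with
      | zero => exact Or.inl (hf A)
      | succ k ih =>
        rcases ih with h | ⟨j, hj, h⟩
        · by_cases h' : KrylovIndep f A (k + 1)
          · exact Or.inl h'
          · exact Or.inr ⟨k, Nat.lt_succ_self k, h, h'⟩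
        · exact Or.inr ⟨j, by omega, h⟩
    rw [Finset.mem_union, Finset.mem_biUnion]
    rcases key with h | ⟨j, hj, h⟩
    · exact Or.inl (Finset.mem_filter.2 ⟨h1, h, fun i _ => h2 i⟩)
    · exact Or.inr ⟨j, Finset.mem_range.2 hj, Finset.mem_filter.2 ⟨h1, h⟩⟩
  have h1 : (((altMatrices ι).filter fun A => ∀ i, f ⬝ᵥ krylov A i = 0).card : ℝ) ≤
      (orthogonalMatrices f k).card + ∑ j ∈ Finset.range k, ((degenerateMatrices f j).card : ℝ) := by
    exact_mod_cast (Finset.card_le_card hsub).trans ((Finset.card_union_le _ _).trans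
      (Nat.add_le_add_left Finset.card_biUnion_le _))
  have h2 : ((orthogonalMatrices f k).card : ℝ) ≤ (altMatrices ι).card * (1 / 2) ^ k :=
    ncard_le_of_mul_two_pow_le (card_orthogonalMatrices_mul_le k)
  have h3 : ∀ j, ((degenerateMatrices f j).card : ℝ) ≤
      4 ^ j * (8 * (altMatrices ι).card / 2 ^ Fintype.card ι) := by
    intro j
    have : ((degenerateMatrices f j).card : ℝ) * 2 ^ Fintype.card ι ≤
        2 ^ (2 * j + 3) * (altMatrices ι).card := by
      exact_mod_cast card_degenerateMatrices_mul_le j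
    rw [← mul_div_assoc, le_div_iff₀ (by positivity)]
    refine this.trans (le_of_eq ?_)
    rw [pow_add, pow_mul]
    ring
  have h4 : ∑ j ∈ Finset.range k, (4 : ℝ) ^ j ≤ 4 ^ k := by
    rw [geom_sum_eq (by norm_num)]
    have : (0 : ℝ) < 4 ^ k := by positivity
    linarith
  calc _ ≤ _ := h1
    _ ≤ (altMatrices ι).card * (1 / 2) ^ k +
        ∑ j ∈ Finset.range k, (4 ^ j * (8 * (altMatrices ι).card / 2 ^ Fintype.card ι) : ℝ) :=
      add_le_add h2 (Finset.sum_le_sum fun j _ => h3 j)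
    _ ≤ (altMatrices ι).card * (1 / 2) ^ k +
        4 ^ k * (8 * (altMatrices ι).card / 2 ^ Fintype.card ι) := by
      rw [← Finset.sum_mul]
      gcongr
    _ = _ := by ring

/-! ### Most graphs are separated by neighbourhood parities -/

/-- Over two elements, the support of `A ^ (i + 1) * 1` is `oddNbrs` of the support of `A ^ i * 1`.
A Boolean algebra on a finite set that separates points contains the singletons. -/
theorem parityDiscrete_of_krylov {G : SimpleGraph ι} [DecidableRel G.Adj]
    (h : ∀ u v, u ≠ v → ∃ i, krylov (G.adjMatrix (ZMod 2)) i u ≠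
      krylov (G.adjMatrix (ZMod 2)) i v) : ParityDiscrete G := by
  intro 𝒢 h𝒢 u
  have hT : ∀ i, {v | krylov (G.adjMatrix (ZMod 2)) i v = 1} ∈ 𝒢 := by
    intro i
    induction i with
    | zero =>
      convert h𝒢.univ_mem
      ext v
      simp [krylov]
    | succ i ih =>
      convert h𝒢.oddNbrs_mem ih using 1
      ext v
      rw [oddNbrs, Set.mem_ofPred_eq, Set.mem_ofPred_eq, krylov, ← ZMod.natCast_eq_one_iff_odd,
        SimpleGraph.adjMatrix_mulVec_apply]
      have : ∀ w, krylov (G.adjMatrix (ZMod 2)) i w =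
          if krylov (G.adjMatrix (ZMod 2)) i w = 1 then 1 else 0 := by
        intro w
        generalize krylov (G.adjMatrix (ZMod 2)) i w = a
        decide +revert
      rw [Finset.sum_congr rfl fun w _ => this w, Finset.sum_boole, ← Set.ncard_coe_finset]
      congr! 3
      ext w
      simp
  have hS : ∀ v, v ≠ u → ∃ S ∈ 𝒢, u ∈ S ∧ v ∉ S := by
    intro v hv
    obtain ⟨i, hi⟩ := h u v hv.symm
    by_cases hu : krylov (G.adjMatrix (ZMod 2)) i u = 1
    · exact ⟨_, hT i, hu, fun hv' => hi (hu.trans hv'.symm)⟩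
    · refine ⟨_, h𝒢.compl_mem (hT i), hu, fun hv' => hv' ?_⟩
      rw [Set.mem_ofPred_eq]
      generalize krylov (G.adjMatrix (ZMod 2)) i u = a at *
      generalize krylov (G.adjMatrix (ZMod 2)) i v = b at *
      clear hv' hT
      decide +revert
  have key : ∀ F : Finset ι, ∃ S ∈ 𝒢, u ∈ S ∧ ∀ v ∈ F, v ≠ u → v ∉ S := by
    intro F
    induction F using Finset.induction_on with
    | empty => exact ⟨_, h𝒢.univ_mem, Set.mem_univ _, by simp⟩
    | insert w F _ ih =>
      obtain ⟨S, hS1, hS2, hS3⟩ := ih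
      by_cases hw : w = u
      · refine ⟨S, hS1, hS2, fun v hv hvu => ?_⟩
        rcases Finset.mem_insert.1 hv with rfl | hv
        · exact absurd hw hvu
        · exact hS3 v hv hvu
      · obtain ⟨T, hT1, hT2, hT3⟩ := hS w hw
        refine ⟨S ∩ T, h𝒢.inter_mem hS1 hT1, ⟨hS2, hT2⟩, fun v hv hvu hvS => ?_⟩
        rcases Finset.mem_insert.1 hv with rfl | hv
        · exact hT3 hvS.2
        · exact hS3 v hv hvu hvS.1
  obtain ⟨S, hS1, hS2, hS3⟩ := key Finset.univ
  convert hS1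
  ext v
  constructor
  · rintro rfl
    exact hS2
  · intro hv
    by_contra hvu
    exact hS3 v (Finset.mem_univ v) hvu hv

theorem card_altMatrices_le : (altMatrices ι).card ≤ Nat.card (SimpleGraph ι) := by
  classical
  let φ : altMatrices ι → SimpleGraph ι := fun A =>
    { Adj := fun u v => A.1 u v = 1
      symm := ⟨fun u v h => ((mem_altMatrices.1 A.2).1.apply u v).trans h⟩
      loopless := ⟨fun u h => by rw [(mem_altMatrices.1 A.2).2 u] at h; exact zero_ne_one h⟩ }
  have hφ : Function.Injective φ := by
    rintro ⟨A, hA⟩ ⟨B, hB⟩ h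
    have h1 : ∀ u v, A u v = 1 ↔ B u v = 1 := fun u v => by
      have := congrArg (fun G => SimpleGraph.Adj G u v) h
      exact iff_of_eq this
    apply Subtype.ext
    ext u v
    have := h1 u v
    simp only
    generalize A u v = a at *
    generalize B u v = b at *
    clear h1 h
    decide +revert
  have := Nat.card_le_card_of_injective φ hφ
  rwa [Nat.card_eq_fintype_card, Fintype.card_coe] at this

/-- At a third vertex `f` vanishes while the all-ones vector does not. -/
theorem krylovIndep_zero (hcard : 3 ≤ Fintype.card ι) {u v : ι} (huv : u ≠ v)
    (A : Matrix ι ι (ZMod 2)) :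
    KrylovIndep (Pi.single u 1 + Pi.single v 1) A 0 := by
  obtain ⟨w, hw⟩ : ∃ w, w ∉ ({u, v} : Finset ι) := by
    by_contra! h
    have h1 : Fintype.card ι ≤ ({u, v} : Finset ι).card :=
      Finset.card_le_card fun w _ => h w
    have := h1.trans Finset.card_le_two
    omega
  simp only [Finset.mem_insert, Finset.mem_singleton, not_or] at hw
  rw [KrylovIndep, Fintype.linearIndependent_iff]
  intro c hc
  have hc' : ∀ i, c 0 * ((Pi.single u 1 : ι → ZMod 2) i + (Pi.single v 1 : ι → ZMod 2) i) + c 1 =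
      0 := by
    intro i
    have := congrFun hc i
    simpa [Fin.sum_univ_two, testSeq, krylov] using this
  have h1 : c 1 = 0 := by simpa [hw.1, hw.2] using hc' w
  have h0 : c 0 = 0 := by simpa [huv, h1] using hc' u
  intro i
  fin_cases i
  · exact h0
  · exact h1

/-- An unseparated pair `u`, `v` means that `e_u + e_v` is orthogonal to all Krylov vectors; union
bound over pairs. -/
theorem ncard_not_parityDiscrete_le (hcard : 3 ≤ Fintype.card ι) (k : ℕ) :
    ({G : SimpleGraph ι | ¬ ParityDiscrete G}.ncard : ℝ) ≤ Nat.card (SimpleGraph ι) *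
      (Fintype.card ι ^ 2 * ((1 / 2) ^ k + 8 * 4 ^ k / 2 ^ Fintype.card ι)) := by
  classical
  set n := Fintype.card ι with hn
  set β : ℝ := (1 / 2) ^ k + 8 * 4 ^ k / 2 ^ n with hβ
  let Bad : ι × ι → Finset (Matrix ι ι (ZMod 2)) := fun p =>
    (altMatrices ι).filter fun A =>
      ∀ i, (Pi.single p.1 1 + Pi.single p.2 1 : ι → ZMod 2) ⬝ᵥ krylov A i = 0
  have hmaps : ∀ G ∈ {G : SimpleGraph ι | ¬ ParityDiscrete G},
      (G.adjMatrix (ZMod 2)) ∈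
        (((Finset.univ.filter fun p : ι × ι => p.1 ≠ p.2).biUnion Bad : Finset _) : Set _) := by
    intro G hG
    have h1 : ∃ u v, u ≠ v ∧ ∀ i, krylov (G.adjMatrix (ZMod 2)) i u =
        krylov (G.adjMatrix (ZMod 2)) i v := by
      by_contra! h
      exact hG (parityDiscrete_of_krylov h)
    obtain ⟨u, v, huv, h⟩ := h1
    rw [Finset.mem_coe, Finset.mem_biUnion]
    refine ⟨(u, v), by simpa using huv, Finset.mem_filter.2 ⟨?_, fun i => ?_⟩⟩
    · rw [mem_altMatrices]
      exact ⟨G.isSymm_adjMatrix, fun i => by simp⟩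
    · rw [add_dotProduct, single_dotProduct, single_dotProduct, h i]
      exact CharTwo.add_self_eq_zero _
  have h1 : {G : SimpleGraph ι | ¬ ParityDiscrete G}.ncard ≤
      ∑ p ∈ Finset.univ.filter (fun p : ι × ι => p.1 ≠ p.2), (Bad p).card := by
    refine le_trans ?_ Finset.card_biUnion_le
    rw [← Set.ncard_coe_finset]
    refine Set.ncard_le_ncard_of_injOn (fun G => G.adjMatrix (ZMod 2)) hmaps ?_ (Set.toFinite _)
    intro G _ H _ h
    ext u v
    have := congrFun (congrFun h u) v
    simp only [SimpleGraph.adjMatrix_apply] at this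
    by_cases hG : G.Adj u v <;> by_cases hH : H.Adj u v <;> simp_all
  have h2 : ∀ p ∈ Finset.univ.filter (fun p : ι × ι => p.1 ≠ p.2),
      ((Bad p).card : ℝ) ≤ Nat.card (SimpleGraph ι) * β := by
    intro p hp
    refine (card_forall_orthogonal_le
      (krylovIndep_zero hcard (by simpa using hp)) k).trans ?_
    have : ((altMatrices ι).card : ℝ) ≤ Nat.card (SimpleGraph ι) := by
      exact_mod_cast card_altMatrices_le
    gcongr
  have hβ0 : 0 ≤ β := by positivity
  calc ({G : SimpleGraph ι | ¬ ParityDiscrete G}.ncard : ℝ)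
      ≤ ∑ p ∈ Finset.univ.filter (fun p : ι × ι => p.1 ≠ p.2), ((Bad p).card : ℝ) := by
        exact_mod_cast h1
    _ ≤ ∑ _p ∈ Finset.univ.filter (fun p : ι × ι => p.1 ≠ p.2), Nat.card (SimpleGraph ι) * β :=
        Finset.sum_le_sum h2
    _ ≤ ∑ _p : ι × ι, Nat.card (SimpleGraph ι) * β :=
        Finset.sum_le_sum_of_subset_of_nonneg (Finset.subset_univ _) fun _ _ _ => by positivity
    _ = _ := by
        simp only [Finset.sum_const, Finset.card_univ, Fintype.card_prod, nsmul_eq_mul, ← hn]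
        push_cast
        ring

end Krylov

/-! ### Almost all graphs -/

/-- Uses `log 2 > 6 / 10`; the rounded exponent is at least `(n - 7) / 6`, whence the 7/10. -/
theorem half_pow_le (n : ℕ) :
    ((1 : ℝ) / 2) ^ ((n - 2) / 6) ≤ Real.exp (7 / 10) * Real.exp (-(1 / 10) * n) := by
  have h2 : (1 : ℝ) / 2 ≤ Real.exp (-(6 / 10)) := by
    rw [Real.exp_neg, one_div]
    refine inv_anti₀ (Real.exp_pos _) ?_
    rw [← Real.le_log_iff_exp_le (by norm_num)]
    linarith [Real.log_two_gt_d9]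
  calc ((1 : ℝ) / 2) ^ ((n - 2) / 6) ≤ Real.exp (-(6 / 10)) ^ ((n - 2) / 6) := by gcongr
    _ = Real.exp (((n - 2) / 6 : ℕ) * -(6 / 10)) := (Real.exp_nat_mul _ _).symm
    _ ≤ Real.exp (7 / 10 + -(1 / 10) * n) := by
      rw [Real.exp_le_exp]
      have : n ≤ 6 * ((n - 2) / 6) + 7 := by omega
      have : (n : ℝ) ≤ 6 * ((n - 2) / 6 : ℕ) + 7 := by exact_mod_cast this
      linarith
    _ = _ := Real.exp_add _ _

/-- The 13 is 11 for the labelled exceptions plus 2 for Burnside. Half of the exponential rate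
absorbs the polynomial factor. -/
theorem eventually_mul_half_pow_le : ∃ N : ℕ, ∀ n : ℕ, N ≤ n →
    13 * ((n : ℝ) ^ 2 * (1 / 2) ^ ((n - 2) / 6)) ≤ Real.exp (-(1 / 20) * n) := by
  have h := tendsto_pow_const_mul_const_pow_of_abs_lt_one 2 (r := Real.exp (-(1 / 20)))
    (by rw [abs_of_pos (Real.exp_pos _), Real.exp_lt_one_iff]; norm_num)
  have hpos : (0 : ℝ) < 1 / (13 * Real.exp (7 / 10)) := by positivity
  obtain ⟨N, hN⟩ := Filter.eventually_atTop.1 (h.eventually_le_const hpos)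
  refine ⟨N, fun n hn => ?_⟩
  have h1 := hN n hn
  rw [← Real.exp_nat_mul, le_div_iff₀ (by positivity), mul_comm (n : ℝ) (-(1 / 20))] at h1
  have h2 : Real.exp (-(1 / 10) * n) = Real.exp (-(1 / 20) * n) * Real.exp (-(1 / 20) * n) := by
    rw [← Real.exp_add]
    congr 1
    ring
  calc 13 * ((n : ℝ) ^ 2 * (1 / 2) ^ ((n - 2) / 6))
      ≤ 13 * ((n : ℝ) ^ 2 * (Real.exp (7 / 10) * Real.exp (-(1 / 10) * n))) := by
        gcongr
        exact half_pow_le n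
    _ = ((n : ℝ) ^ 2 * Real.exp (-(1 / 20) * n) * (13 * Real.exp (7 / 10))) *
        Real.exp (-(1 / 20) * n) := by
        rw [h2]
        ring
    _ ≤ 1 * Real.exp (-(1 / 20) * n) := by gcongr
    _ = _ := one_mul _

theorem one_add_pow_le {n : ℕ} {z : ℝ} (hz : 0 ≤ z) (h : (n : ℝ) ^ 2 * z ≤ 1) :
    (1 + n * z) ^ n ≤ 1 + 2 * ((n : ℝ) ^ 2 * z) := by
  have h0 : 0 ≤ (n : ℝ) ^ 2 * z := by positivity
  have h1 : (1 + n * z) ^ n ≤ Real.exp ((n : ℝ) ^ 2 * z) := by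
    calc (1 + n * z) ^ n ≤ Real.exp (n * z) ^ n := by
          gcongr
          linarith [Real.add_one_le_exp (n * z)]
      _ = Real.exp ((n : ℝ) ^ 2 * z) := by
          rw [← Real.exp_nat_mul]
          congr 1
          ring
  have h2 := Real.abs_exp_sub_one_le (x := (n : ℝ) ^ 2 * z) (by rwa [abs_of_nonneg h0])
  rw [abs_of_nonneg h0] at h2
  linarith [le_abs_self (Real.exp ((n : ℝ) ^ 2 * z) - 1)]

/-- The 11 is 2 from disconnected graphs plus 9 from those that are not parity discrete. -/
theorem unweightedFull_fraction_le {n : ℕ} (hn : 3 ≤ n) {z : ℝ}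
    (hz : z = (1 / 2) ^ ((n - 2) / 6)) (h : (n : ℝ) ^ 2 * z ≤ 1) :
    (1 - 11 * ((n : ℝ) ^ 2 * z)) * (Nat.card (SimpleGraph (Fin n)) : ℝ) ≤
      ({G : SimpleGraph (Fin n) | UnweightedFull G}.ncard : ℝ) := by
  have : Nonempty (Fin n) := ⟨⟨0, by omega⟩⟩
  have hz0 : 0 ≤ z := by rw [hz]; positivity
  have h1 := ncard_not_connected_le (ι := Fin n)
  -- With `k = n / 4` both terms decay exponentially: `4 ^ k / 2 ^ n` is at most `(1 / 2) ^ k`,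
  -- because `3 k ≤ n`.
  have h2 := ncard_not_parityDiscrete_le (ι := Fin n) (by simpa using hn) (n / 4)
  rw [Fintype.card_fin] at h1 h2
  set M : ℝ := ((Nat.card (SimpleGraph (Fin n)) : ℕ) : ℝ) with hM
  have hM0 : 0 ≤ M := by positivity
  have h3 : (1 + (1 / 2) ^ (n / 2) : ℝ) ^ n - 1 ≤ 2 * ((n : ℝ) ^ 2 * z) := by
    have h4 : (1 / 2 : ℝ) ^ (n / 2) ≤ n * z := by
      have h5 : (1 / 2 : ℝ) ^ (n / 2) ≤ z := by
        rw [hz]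
        exact pow_le_pow_of_le_one (by norm_num) (by norm_num) (by omega)
      have h6 : (1 : ℝ) ≤ n := by exact_mod_cast (by omega : 1 ≤ n)
      exact h5.trans (le_mul_of_one_le_left hz0 h6)
    have h5 : (1 + (1 / 2) ^ (n / 2) : ℝ) ^ n ≤ (1 + n * z) ^ n := by gcongr
    linarith [one_add_pow_le hz0 h]
  have h4 : (1 / 2 : ℝ) ^ (n / 4) + 8 * 4 ^ (n / 4) / 2 ^ n ≤ 9 * z := by
    have h5 : (1 / 2 : ℝ) ^ (n / 4) ≤ z := by
      rw [hz]
      exact pow_le_pow_of_le_one (by norm_num) (by norm_num) (by omega)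
    have h6 : (4 : ℝ) ^ (n / 4) / 2 ^ n ≤ (1 / 2) ^ (n / 4) := by
      rw [div_le_iff₀ (by positivity), one_div, inv_pow, inv_mul_eq_div,
        le_div_iff₀ (by positivity), ← mul_pow]
      calc ((4 : ℝ) * 2) ^ (n / 4) = 2 ^ (3 * (n / 4)) := by
            rw [pow_mul]
            norm_num
        _ ≤ 2 ^ n := pow_le_pow_right₀ (by norm_num) (by omega)
    rw [mul_div_assoc]
    linarith
  have hsub : (Set.univ : Set (SimpleGraph (Fin n))) ⊆ {G | UnweightedFull G} ∪
      ({G | ¬ G.Connected} ∪ {G | ¬ ParityDiscrete G}) := by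
    intro G _
    by_cases hG : G.Connected
    · by_cases hP : ParityDiscrete G
      · exact Or.inl ⟨hG, hP.dla_eq_su hG⟩
      · exact Or.inr (Or.inr hP)
    · exact Or.inr (Or.inl hG)
  have h5 : M ≤ ({G : SimpleGraph (Fin n) | UnweightedFull G}.ncard : ℝ) +
      (({G : SimpleGraph (Fin n) | ¬ G.Connected}.ncard : ℝ) +
        ({G : SimpleGraph (Fin n) | ¬ ParityDiscrete G}.ncard : ℝ)) := by
    have h6 := Set.ncard_le_ncard hsub (Set.toFinite _)
    rw [Set.ncard_univ] at h6
    have h7 := Set.ncard_union_le {G : SimpleGraph (Fin n) | UnweightedFull G}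
      ({G | ¬ G.Connected} ∪ {G | ¬ ParityDiscrete G})
    have h8 := Set.ncard_union_le {G : SimpleGraph (Fin n) | ¬ G.Connected}
      {G | ¬ ParityDiscrete G}
    rw [hM]
    exact_mod_cast h6.trans (h7.trans (Nat.add_le_add_left h8 _))
  have h6 : M * ((1 + (1 / 2) ^ (n / 2) : ℝ) ^ n - 1) ≤ M * (2 * ((n : ℝ) ^ 2 * z)) := by gcongr
  have h7 : M * ((n : ℝ) ^ 2 * ((1 / 2 : ℝ) ^ (n / 4) + 8 * 4 ^ (n / 4) / 2 ^ n)) ≤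
      M * ((n : ℝ) ^ 2 * (9 * z)) := by gcongr
  linarith

theorem almost_all_unweightedFull : ∃ c : ℝ, 0 < c ∧ ∃ N : ℕ, ∀ n : ℕ, N ≤ n →
    (1 - Real.exp (-c * n)) * (Nat.card (SimpleGraph (Fin n)) : ℝ) ≤
      ({G : SimpleGraph (Fin n) | UnweightedFull G}.ncard : ℝ) ∧
    (1 - Real.exp (-c * n)) * (Nat.card (GraphClass n) : ℝ) ≤
      (Set.ncard (Quotient.mk (isoSetoid n) ''
        {G : SimpleGraph (Fin n) | UnweightedFull G}) : ℝ) := by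
  obtain ⟨N, hN⟩ := eventually_mul_half_pow_le
  refine ⟨1 / 20, by norm_num, max N 3, fun n hn => ?_⟩
  have h13 := hN n (le_of_max_le_left hn)
  have hn3 : 3 ≤ n := le_of_max_le_right hn
  obtain ⟨z, hz⟩ : ∃ z : ℝ, z = (1 / 2) ^ ((n - 2) / 6) := ⟨_, rfl⟩
  rw [← hz] at h13
  have hz0 : 0 ≤ z := by rw [hz]; positivity
  have ht0 : 0 ≤ (n : ℝ) ^ 2 * z := by positivity
  have ht1 : (n : ℝ) ^ 2 * z ≤ 1 := by
    have : Real.exp (-(1 / 20) * n) ≤ 1 := by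
      rw [Real.exp_le_one_iff]
      have : (0 : ℝ) ≤ n := by positivity
      linarith
    linarith
  have hfull := unweightedFull_fraction_le hn3 hz ht1
  constructor
  · refine le_trans (mul_le_mul_of_nonneg_right ?_ (by positivity)) hfull
    linarith
  · have hpow := one_add_pow_le hz0 ht1
    rw [hz] at hpow
    have hclass := class_fraction_le (by positivity) (by positivity) hfull hpow
    refine le_trans (mul_le_mul_of_nonneg_right ?_ (by positivity)) hclass
    rw [← hz]
    linarith

end GraphDLA

end

theorem mainTheorem11 :
    -- weighted connected graphs whose weights satisfy the genericity conditions
    (∀ (V : Type*) [Fintype V] [DecidableEq V] (G : SimpleGraph V) (r : Sym2 V → ℝ),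
      G.Connected → GraphDLA.GenericWeights G r →
        GraphDLA.dla G r = GraphDLA.su (V → Fin 2) ∧
        Module.finrank ℝ (GraphDLA.dla G r) = 4 ^ Fintype.card V - 1) ∧
    -- unweighted asymmetrically subdivided odd graphs
    (∀ (V : Type*) [Fintype V] [DecidableEq V] (G : SimpleGraph V),
      GraphDLA.IsAsymSubdividedOddGraph G →
        GraphDLA.dla G (fun _ => 1) = GraphDLA.su (V → Fin 2) ∧
        Module.finrank ℝ (GraphDLA.dla G (fun _ => 1)) = 4 ^ Fintype.card V - 1) ∧
    -- almost all unweighted graphs, among labelled graphs and among isomorphism classes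
    (∃ c : ℝ, 0 < c ∧ ∃ N : ℕ, ∀ n : ℕ, N ≤ n →
      (1 - Real.exp (-c * n)) * (Nat.card (SimpleGraph (Fin n)) : ℝ) ≤
        ({G : SimpleGraph (Fin n) | GraphDLA.UnweightedFull G}.ncard : ℝ) ∧
      (1 - Real.exp (-c * n)) * (Nat.card (GraphDLA.GraphClass n) : ℝ) ≤
        (Set.ncard (Quotient.mk (GraphDLA.isoSetoid n) ''
          {G : SimpleGraph (Fin n) | GraphDLA.UnweightedFull G}) : ℝ)) := by
  refine ⟨fun V _ _ G r hG hr => ?_, fun V _ _ G hG => hG.dla_eq_su, ?_⟩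
  · exact GraphDLA.dla_eq_su_of_controls hG hr.1
      (GraphDLA.controls_singleton_of_genericWeights hr)
  · exact GraphDLA.almost_all_unweightedFull
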